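/- Let $d\ge 0$, $\ell\ge 1$ be integers, let $A$ be a non-singular real $d\times d$ matrix with $\|A\|<1$ (Euclidean operator norm), let $c_1,\dots,c_\ell\in\mathbb R^d$, and let $S_i(x)=Ax+c_i$ ($1\le i\le \ell$). Let $K\subset\mathbb R^d$ be the attractor of $\{S_i\}_{i=1}^\ell$, i.e. the unique non-empty compact set with $K=\bigcup_{i=1}^\ell S_i(K)$. Let $\Sigma=\{1,\dots,\ell\}^{\mathbb N}$ with the left shift $\sigma$, let $\mathcal M_\sigma(\Sigma)$ be the set of $\sigma$-invariant Borel probability measures on $\Sigma$, and let $\pi:\Sigma\to K$ be the canonical projection, $\{\pi(x)\}=\bigcap_{n\ge1}S_{x_1}\circ\cdots\circ S_{x_n}(K)$. For a probability measure $m$ on $\Sigma$, a countable measurable partition $\xi$ and a sub-$\sigma$-algebra $\mathcal A$ of the Borel $\sigma$-algebra, put $$\mathbf I_m(\xi|\mathcal A)=-\sum_{B\in\xi}\chi_B\log \mathbf E_m(\chi_B|\mathcal A),\qquad H_m(\xi|\mathcal A)=\int \mathbf I_m(\xi|\mathcal A)\,dm,$$ and let $H_m(\xi)$ be $H_m(\xi|\mathcal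 A)$ for the trivial $\sigma$-algebra $\mathcal A$. Let $\mathcal P=\{[j]:1\le j\le\ell\}$ with $[j]=\{x\in\Sigma: x_1=j\}$, let $\gamma$ be the Borel $\sigma$-algebra of $\mathbb R^d$, and define the projection entropy of $m\in\mathcal M_\sigma(\Sigma)$ by $$h_\pi(\sigma,m)=H_m(\mathcal P|\sigma^{-1}\pi^{-1}\gamma)-H_m(\mathcal P|\pi^{-1}\gamma).$$ Let $\mathcal Q=\{[0,1)^d+\alpha:\alpha\in\mathbb Z^d\}$ and $\mathcal Q_n=\{A^nQ:Q\in\mathcal Q\}$ for $n\ge 0$. Then: (i) For every $m\in\mathcal M_\sigma(\Sigma)$, the information functions that define $H_m(\mathcal P|\sigma^{-1}\pi^{-1}\gamma)$, $H_m(\mathcal P|\pi^{-1}\gamma)$ and $H_m(\pi^{-1}\mathcal Q_n)$ ($n\ge0$) are $m$-integrable, so that these entropies are finite, and $$h_\pi(\sigma,m)=\lim_{n\to\infty}\frac{H_m(\pi^{-1}\mathcal Q_n)}{n}.$$ (ii) The set $\{Q\in\mathcal Q: A^nQ\cap K\neq\emptyset\}$ is finite for every $n\ge 0$, the set $\{h_\pi(\sigma,m):m\in\mathcal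 M_\sigma(\Sigma)\}$ is bounded above, and $$\lim_{n\to\infty}\frac{\log\#\{Q\in\mathcal Q: A^nQ\cap K\neq\emptyset\}}{n}=\sup\{h_\pi(\sigma,m):m\in\mathcal M_\sigma(\Sigma)\}.$$ -/

import Mathlib

open Set Filter Topology MeasureTheory
open scoped NNReal ENNReal

noncomputable section

/-! ### Symbolic space -/

/-- The one-sided full shift space over `ℓ` symbols. -/
abbrev ShiftSpace (ℓ : ℕ) : Type := ℕ → Fin ℓ

/-- The left shift `(x₀, x₁, x₂, …) ↦ (x₁, x₂, …)`. -/
def leftShift {ℓ : ℕ} (x : ShiftSpace ℓ) : ShiftSpace ℓ := fun n => x (n + 1)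

/-- The shift-invariant Borel probability measures on the full shift. -/
def invariantMeasures (ℓ : ℕ) : Set (Measure (ShiftSpace ℓ)) :=
  {m | IsProbabilityMeasure m ∧ MeasurePreserving leftShift m m}

/-- The one-cylinder `[j]` of sequences that start with the symbol `j`. -/
def cylinderOne {ℓ : ℕ} (j : Fin ℓ) : Set (ShiftSpace ℓ) := {x | x 0 = j}

/-! ### Iterated function systems -/

/-- `wordMap S x n = S_{x₀} ∘ S_{x₁} ∘ ⋯ ∘ S_{x_{n-1}}`. -/
def wordMap {ℓ : ℕ} {E : Type*} (S : Fin ℓ → E → E) (x : ShiftSpace ℓ) : ℕ → E → E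
  | 0 => id
  | n + 1 => wordMap S x n ∘ S (x n)

/-- `K` is a nonempty compact set with `K = ⋃ i, S_i(K)`. -/
def IsAttractor {ℓ : ℕ} {E : Type*} [TopologicalSpace E] (S : Fin ℓ → E → E) (K : Set E) : Prop :=
  K.Nonempty ∧ IsCompact K ∧ K = ⋃ i, S i '' K

open Classical in
/-- The attractor of an iterated function system. For finitely many (and at least one) contractions
of a complete space it exists and is unique: see `isAttractor_attractor`, `IsAttractor.unique`. -/
def attractor {ℓ : ℕ} {E : Type*} [TopologicalSpace E] (S : Fin ℓ → E → E) : Set E :=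
  if h : ∃ K, IsAttractor S K then h.choose else ∅

open Classical in
/-- The canonical projection from the shift space to the attractor `K`: `codingMap S x` is the unique
point of `⋂_{n ≥ 1} S_{x₀} ∘ ⋯ ∘ S_{x_{n-1}} (K)`; see `singleton_codingMap`. -/
def codingMap {ℓ : ℕ} {E : Type*} [TopologicalSpace E] [Nonempty E] (S : Fin ℓ → E → E)
    (x : ShiftSpace ℓ) : E :=
  if h : ∃ p, {p} = ⋂ n : ℕ, wordMap S x (n + 1) '' attractor S then h.choose
  else Classical.arbitrary E

section Facts

variable {ℓ : ℕ} {E : Type*}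

lemma wordMap_succ' (S : Fin ℓ → E → E) (x : ShiftSpace ℓ) (n : ℕ) :
    wordMap S x (n + 1) = S (x 0) ∘ wordMap S (leftShift x) n := by
  induction n with
  | zero => rfl
  | succ n ih =>
    rw [wordMap, ih]
    rfl

variable [MetricSpace E] {S : Fin ℓ → E → E} {r : ℝ≥0}

lemma lipschitzWith_wordMap (hS : ∀ i, LipschitzWith r (S i)) (x : ShiftSpace ℓ) (n : ℕ) :
    LipschitzWith (r ^ n) (wordMap S x n) := by
  induction n with
  | zero =>
    rw [pow_zero]
    exact LipschitzWith.id
  | succ n ih =>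
    rw [pow_succ]
    exact ih.comp (hS (x n))

lemma continuous_wordMap (hS : ∀ i, LipschitzWith r (S i)) (n : ℕ) :
    Continuous fun q : ShiftSpace ℓ × E => wordMap S q.1 n q.2 := by
  induction n with
  | zero => exact continuous_snd
  | succ n ih =>
    have h1 : Continuous fun q : Fin ℓ × E => S q.1 q.2 :=
      continuous_prod_of_discrete_left.2 fun i => (hS i).continuous
    have h0 : Continuous fun q : ShiftSpace ℓ × E => (q.1 n, q.2) := by fun_prop
    have h2 : Continuous fun q : ShiftSpace ℓ × E => S (q.1 n) q.2 := h1.comp h0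
    exact ih.comp (continuous_fst.prodMk h2)

lemma exists_limit_wordMap [CompleteSpace E] (hr : r < 1) (hS : ∀ i, LipschitzWith r (S i)) (e : E) :
    ∃ p : ShiftSpace ℓ → E, Continuous p ∧
      ∀ x, Tendsto (fun n => wordMap S x n e) atTop (𝓝 (p x)) := by
  have hr' : (r : ℝ) < 1 := hr
  obtain ⟨C, hC⟩ : ∃ C : ℝ, ∀ i, dist e (S i e) ≤ C := by
    obtain ⟨C, hC⟩ := (Set.finite_range fun i => dist e (S i e)).bddAbove
    exact ⟨C, fun i => hC ⟨i, rfl⟩⟩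
  have hstep : ∀ x n, dist (wordMap S x n e) (wordMap S x (n + 1) e) ≤ C * (r : ℝ) ^ n := by
    intro x n
    calc dist (wordMap S x n e) (wordMap S x n (S (x n) e))
        ≤ ((r ^ n : ℝ≥0) : ℝ) * dist e (S (x n) e) := (lipschitzWith_wordMap hS x n).dist_le_mul _ _
      _ ≤ C * (r : ℝ) ^ n := by
        rw [mul_comm C]
        push_cast
        exact mul_le_mul_of_nonneg_left (hC _) (by positivity)
  have hlim : ∀ x, ∃ p, Tendsto (fun n => wordMap S x n e) atTop (𝓝 p) := fun x =>
    cauchySeq_tendsto_of_complete (cauchySeq_of_le_geometric r C hr' (hstep x))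
  choose p hp using hlim
  refine ⟨p, ?_, hp⟩
  have hunif : TendstoUniformly (fun n x => wordMap S x n e) p atTop := by
    rw [Metric.tendstoUniformly_iff]
    intro ε hε
    have h0 : Tendsto (fun n : ℕ => C * (r : ℝ) ^ n / (1 - r)) atTop (𝓝 0) := by
      simpa using ((tendsto_pow_atTop_nhds_zero_of_lt_one r.coe_nonneg hr').const_mul C).div_const
        (1 - (r : ℝ))
    filter_upwards [h0.eventually (gt_mem_nhds hε)] with n hn x
    rw [dist_comm]
    exact (dist_le_of_le_geometric_of_tendsto r C hr' (hstep x) (hp x) n).trans_lt hn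
  exact hunif.continuous (Frequently.of_forall fun n =>
    (continuous_wordMap hS n).comp (continuous_id.prodMk continuous_const))

lemma exists_isAttractor [CompleteSpace E] [Nonempty E] (hℓ : 1 ≤ ℓ) (hr : r < 1)
    (hS : ∀ i, LipschitzWith r (S i)) : ∃ K, IsAttractor S K := by
  obtain ⟨p, hpc, hp⟩ := exists_limit_wordMap hr hS (Classical.arbitrary E)
  have key : ∀ x, p x = S (x 0) (p (leftShift x)) := by
    intro x
    refine tendsto_nhds_unique ((tendsto_add_atTop_iff_nat 1).2 (hp x)) ?_
    simp only [wordMap_succ']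
    exact ((hS (x 0)).continuous.tendsto _).comp (hp (leftShift x))
  refine ⟨range p, ⟨p fun _ => ⟨0, hℓ⟩, mem_range_self _⟩, isCompact_range hpc, ?_⟩
  ext y
  simp only [mem_range, mem_iUnion, mem_image]
  constructor
  · rintro ⟨x, rfl⟩
    exact ⟨x 0, _, ⟨leftShift x, rfl⟩, (key x).symm⟩
  · rintro ⟨i, _, ⟨x, rfl⟩, rfl⟩
    let z : ShiftSpace ℓ := fun n => Nat.casesOn n i x
    exact ⟨z, key z⟩

lemma isAttractor_attractor [CompleteSpace E] [Nonempty E] (hℓ : 1 ≤ ℓ) (hr : r < 1)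
    (hS : ∀ i, LipschitzWith r (S i)) : IsAttractor S (attractor S) := by
  have h := exists_isAttractor hℓ hr hS
  rw [attractor, dif_pos h]
  exact h.choose_spec

lemma IsAttractor.image_subset {K : Set E} (hK : IsAttractor S K) (i : Fin ℓ) : S i '' K ⊆ K := by
  conv_rhs => rw [hK.2.2]
  exact subset_iUnion (fun i => S i '' K) i

lemma IsAttractor.exists_word {K : Set E} (hK : IsAttractor S K) (n : ℕ) :
    ∀ y ∈ K, ∃ x : ShiftSpace ℓ, ∃ z ∈ K, wordMap S x n z = y := by
  induction n with
  | zero =>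
    intro y hy
    have hy' := hy
    rw [hK.2.2] at hy'
    obtain ⟨i, -⟩ := mem_iUnion.1 hy'
    exact ⟨fun _ => i, y, hy, rfl⟩
  | succ n ih =>
    intro y hy
    rw [hK.2.2] at hy
    obtain ⟨i, w, hw, rfl⟩ := mem_iUnion.1 hy
    obtain ⟨x, z, hz, rfl⟩ := ih w hw
    let x' : ShiftSpace ℓ := fun n => Nat.casesOn n i x
    exact ⟨x', z, hz, by rw [wordMap_succ' S x' n]; rfl⟩

lemma IsAttractor.wordMap_mem {K : Set E} (hK : IsAttractor S K) (x : ShiftSpace ℓ) (n : ℕ) :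
    ∀ z ∈ K, wordMap S x n z ∈ K := by
  induction n with
  | zero => exact fun z hz => hz
  | succ n ih => exact fun z hz => ih _ (hK.image_subset _ ⟨z, hz, rfl⟩)

lemma IsAttractor.unique (hr : r < 1) (hS : ∀ i, LipschitzWith r (S i)) {K L : Set E}
    (hK : IsAttractor S K) (hL : IsAttractor S L) : K = L := by
  have main : ∀ {K L : Set E}, IsAttractor S K → IsAttractor S L → K ⊆ L := by
    intro K L hK hL y hy
    obtain ⟨w, hw⟩ := hL.1
    obtain ⟨C, hC⟩ := hK.2.1.isBounded.subset_closedBall w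
    rw [← hL.2.1.isClosed.closure_eq, Metric.mem_closure_iff]
    intro ε hε
    have h0 : Tendsto (fun n : ℕ => (r : ℝ) ^ n * C) atTop (𝓝 0) := by
      simpa using (tendsto_pow_atTop_nhds_zero_of_lt_one r.coe_nonneg
        (show (r : ℝ) < 1 from hr)).mul_const C
    obtain ⟨n, hn⟩ := (h0.eventually (gt_mem_nhds hε)).exists
    obtain ⟨x, z, hz, rfl⟩ := hK.exists_word n y hy
    refine ⟨wordMap S x n w, hL.wordMap_mem x n w hw, ?_⟩
    refine ((lipschitzWith_wordMap hS x n).dist_le_mul z w).trans_lt (lt_of_le_of_lt ?_ hn)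
    push_cast
    exact mul_le_mul_of_nonneg_left (hC hz) (by positivity)
  exact (main hK hL).antisymm (main hL hK)

lemma singleton_codingMap [CompleteSpace E] [Nonempty E] (hℓ : 1 ≤ ℓ) (hr : r < 1)
    (hS : ∀ i, LipschitzWith r (S i)) (x : ShiftSpace ℓ) :
    {codingMap S x} = ⋂ n : ℕ, wordMap S x (n + 1) '' attractor S := by
  have hK := isAttractor_attractor hℓ hr hS
  have hcomp : ∀ n, IsCompact (wordMap S x (n + 1) '' attractor S) := fun n =>
    hK.2.1.image (lipschitzWith_wordMap hS x (n + 1)).continuous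
  have hex : ∃ p, {p} = ⋂ n : ℕ, wordMap S x (n + 1) '' attractor S := by
    obtain ⟨p, hp⟩ := IsCompact.nonempty_iInter_of_sequence_nonempty_isCompact_isClosed
      (fun n => wordMap S x (n + 1) '' attractor S)
      (fun n => by
        rintro _ ⟨z, hz, rfl⟩
        exact ⟨S (x (n + 1)) z, hK.image_subset _ ⟨z, hz, rfl⟩, rfl⟩)
      (fun n => hK.1.image _) (hcomp 0) (fun n => (hcomp n).isClosed)
    refine ⟨p, Subset.antisymm (singleton_subset_iff.2 hp) fun q hq => ?_⟩
    have hle : ∀ n : ℕ, dist q p ≤ (r : ℝ) ^ (n + 1) * Metric.diam (attractor S) := by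
      intro n
      obtain ⟨a, ha, rfl⟩ := mem_iInter.1 hq n
      obtain ⟨b, hb, hbp⟩ := mem_iInter.1 hp n
      rw [← hbp]
      refine ((lipschitzWith_wordMap hS x (n + 1)).dist_le_mul a b).trans ?_
      push_cast
      exact mul_le_mul_of_nonneg_left (Metric.dist_le_diam_of_mem hK.2.1.isBounded ha hb)
        (by positivity)
    have h0 : Tendsto (fun n : ℕ => (r : ℝ) ^ (n + 1) * Metric.diam (attractor S)) atTop (𝓝 0) := by
      simpa using ((tendsto_add_atTop_iff_nat 1).2 (tendsto_pow_atTop_nhds_zero_of_lt_one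
        r.coe_nonneg (show (r : ℝ) < 1 from hr))).mul_const (Metric.diam (attractor S))
    exact dist_le_zero.1 (ge_of_tendsto' h0 hle)
  rw [codingMap, dif_pos hex]
  exact hex.choose_spec

lemma continuous_codingMap [CompleteSpace E] [Nonempty E] (hℓ : 1 ≤ ℓ) (hr : r < 1)
    (hS : ∀ i, LipschitzWith r (S i)) : Continuous (codingMap S) := by
  have hK := isAttractor_attractor hℓ hr hS
  obtain ⟨e, he⟩ := hK.1
  obtain ⟨p, hpc, hp⟩ := exists_limit_wordMap hr hS e
  suffices h : codingMap S = p by rwa [h]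
  funext x
  have hmem : p x ∈ ⋂ n : ℕ, wordMap S x (n + 1) '' attractor S := by
    refine mem_iInter.2 fun n => ?_
    have hcl : IsClosed (wordMap S x (n + 1) '' attractor S) :=
      (hK.2.1.image (lipschitzWith_wordMap hS x (n + 1)).continuous).isClosed
    refine hcl.mem_of_tendsto (hp x) ?_
    filter_upwards [eventually_ge_atTop (n + 1)] with k hk
    induction k, hk using Nat.le_induction generalizing e with
    | base => exact ⟨e, he, rfl⟩
    | succ k hk ih =>
      have hs : ∀ k ≥ n + 1, ∀ z ∈ attractor S,
          wordMap S x k z ∈ wordMap S x (n + 1) '' attractor S := by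
        intro k hk
        induction k, hk using Nat.le_induction with
        | base => exact fun z hz => ⟨z, hz, rfl⟩
        | succ k hk ih => exact fun z hz => ih _ (hK.image_subset _ ⟨z, hz, rfl⟩)
      exact hs (k + 1) (by omega) e he
  rw [← singleton_codingMap hℓ hr hS x] at hmem
  exact (mem_singleton_iff.1 hmem).symm

end Facts

/-! ### Entropy -/

/-- The conditional information `I_m(ξ | 𝒜) = - ∑_i 1_{A_i} log E_m(1_{A_i} | 𝒜)` of the countable
partition `ξ = {A_i}` given the `σ`-algebra `𝒜`. -/
def condInformation {Ω ι : Type*} (𝒜 : MeasurableSpace Ω) [MeasurableSpace Ω] (m : Measure Ω)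
    (A : ι → Set Ω) (x : Ω) : ℝ :=
  -∑' i, (A i).indicator (fun _ => (1 : ℝ)) x *
    Real.log ((m[(A i).indicator (fun _ => (1 : ℝ)) | 𝒜]) x)

/-- The conditional entropy `H_m(ξ | 𝒜) = ∫ I_m(ξ | 𝒜) dm`. -/
def condEntropy {Ω ι : Type*} (𝒜 : MeasurableSpace Ω) [MeasurableSpace Ω] (m : Measure Ω)
    (A : ι → Set Ω) : ℝ :=
  ∫ x, condInformation 𝒜 m A x ∂m

/-- The entropy `H_m(ξ)`: conditional entropy given the trivial `σ`-algebra. -/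
def partEntropy {Ω ι : Type*} [MeasurableSpace Ω] (m : Measure Ω) (A : ι → Set Ω) : ℝ :=
  condEntropy ⊥ m A

/-- The `σ`-algebra `π⁻¹ γ` on the shift space, with `γ` the Borel `σ`-algebra of `E`. -/
abbrev codingSigma {ℓ : ℕ} {E : Type*} [TopologicalSpace E] [Nonempty E] (S : Fin ℓ → E → E) :
    MeasurableSpace (ShiftSpace ℓ) :=
  (borel E).comap (codingMap S)

/-- The projection entropy `h_π(σ, m) = H_m(𝒫 | σ⁻¹ π⁻¹ γ) - H_m(𝒫 | π⁻¹ γ)`, with `𝒫` the partition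
of the shift space into one-cylinders. -/
def projEntropy {ℓ : ℕ} {E : Type*} [TopologicalSpace E] [Nonempty E] (S : Fin ℓ → E → E)
    (m : Measure (ShiftSpace ℓ)) : ℝ :=
  condEntropy ((codingSigma S).comap leftShift) m cylinderOne -
    condEntropy (codingSigma S) m cylinderOne

/-! ### Affine systems with a common linear part -/

/-- The maps `S_i(x) = A x + c_i` on Euclidean space. -/
def affineIFS {d ℓ : ℕ} (A : Matrix (Fin d) (Fin d) ℝ) (c : Fin ℓ → EuclideanSpace ℝ (Fin d))
    (i : Fin ℓ) (x : EuclideanSpace ℝ (Fin d)) : EuclideanSpace ℝ (Fin d) :=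
  Matrix.toEuclideanCLM (𝕜 := ℝ) A x + c i

lemma lipschitzWith_affineIFS {d ℓ : ℕ} (A : Matrix (Fin d) (Fin d) ℝ)
    (c : Fin ℓ → EuclideanSpace ℝ (Fin d)) (i : Fin ℓ) :
    LipschitzWith ‖Matrix.toEuclideanCLM (𝕜 := ℝ) A‖₊ (affineIFS A c i) := by
  refine LipschitzWith.of_dist_le_mul fun x y => ?_
  simp only [affineIFS, dist_add_right]
  exact (Matrix.toEuclideanCLM (𝕜 := ℝ) A).lipschitz.dist_le_mul x y

/-- The half-open unit cube `[0,1)^d + α`, `α ∈ ℤ^d`. -/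
def unitCube {d : ℕ} (α : Fin d → ℤ) : Set (EuclideanSpace ℝ (Fin d)) :=
  {x | ∀ j, (α j : ℝ) ≤ x j ∧ x j < (α j : ℝ) + 1}

/-- The element `A^n ([0,1)^d + α)` of the partition `𝒬_n = A^n 𝒬`. -/
def cubeImage {d : ℕ} (A : Matrix (Fin d) (Fin d) ℝ) (n : ℕ) (α : Fin d → ℤ) :
    Set (EuclideanSpace ℝ (Fin d)) :=
  Matrix.toEuclideanCLM (𝕜 := ℝ) (A ^ n) '' unitCube α

/-- The countable partition `π⁻¹ 𝒬_n` of the shift space. -/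
def pulledCubes {d ℓ : ℕ} (A : Matrix (Fin d) (Fin d) ℝ) (c : Fin ℓ → EuclideanSpace ℝ (Fin d))
    (n : ℕ) (α : Fin d → ℤ) : Set (ShiftSpace ℓ) :=
  codingMap (affineIFS A c) ⁻¹' cubeImage A n α

/-- The cubes `Q = [0,1)^d + α` of the lattice partition for which `A^n Q` meets the attractor. -/
def meetingCubes {d ℓ : ℕ} (A : Matrix (Fin d) (Fin d) ℝ) (c : Fin ℓ → EuclideanSpace ℝ (Fin d))
    (n : ℕ) : Set (Set (EuclideanSpace ℝ (Fin d))) :=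
  {Q | Q ∈ range (unitCube (d := d)) ∧
    (Matrix.toEuclideanCLM (𝕜 := ℝ) (A ^ n) '' Q ∩ attractor (affineIFS A c)).Nonempty}

end

/-! Write `π` for the coding map, `Γ = π⁻¹γ`, `H` for entropy, `P_k` for the partition by the first
`k` symbols and `b_n = H(π⁻¹𝒬_n)`. All maps have linear part `A`, so `A^{-(n+k)} π(x) = A^{-n} π(σ^k
x) + v`, where `v` depends only on `n`, `k` and the first `k` symbols (`linPowInv_codingMap`). Given
these symbols, the cube of `x` at level `n+k` and the cube of `σ^k x` at level `n` therefore
determine each other up to `2^d` choices.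

For (i), the chain rule `finEntropy_prod` and this comparison give `b_{n+k} - b_n = H(P_k |
σ^{-k}π⁻¹𝒬_n) - H(P_k | π⁻¹𝒬_{n+k}) + O(d log 2)`. As `n → ∞` the cells shrink and the difference of
entropies tends to `H(P_k | σ^{-k}Γ) - H(P_k | Γ)` (`tendsto_finEntropy_comap`), which is `k h_π` by
telescoping (`finEntropy_itinerary_sub`). The error does not depend on `k`, so `b_n / n → h_π`
(`tendsto_div_of_eventually_abs_sub_le`).

For (ii), let `N_n` be the number of cubes met. Since `b_n ≤ log N_n`, each `h_π(σ, m)` is at most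
`liminf (log N_n)/n`. Conversely, choose one sequence per cube of level `n`, concatenate independent
uniform blocks made of their first `n` symbols, and average the law over `n` shifts. A cube of level
`nN` is compatible with at most `C^N` choices of `N` blocks, with `C` independent of `n`
(`ncard_blocks_le`), so its mass is at most `ℓ^n (C/N_n)^N`. Letting `N → ∞` in (i) gives an
invariant `m` with `h_π(σ, m) ≥ (log N_n - log C)/n` (`exists_invariantMeasure_le_projEntropy`). The
two bounds together yield both the existence of the limit and its value. -/

open scoped ProbabilityTheory

/-! ### Conditional probabilities and integrability of the information function. -/

section CondProb

variable {Ω : Type*} {𝒜 m0 : MeasurableSpace Ω} {m : Measure Ω}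

lemma condProb_nonneg (s : Set Ω) : ∀ᵐ x ∂m, 0 ≤ (m⟦s|𝒜⟧) x :=
  condExp_nonneg (ae_of_all _ fun x => indicator_nonneg (fun _ _ => zero_le_one) x)

variable [IsProbabilityMeasure m]

lemma integrable_indicator_one {s : Set Ω} (hs : MeasurableSet s) :
    Integrable (s.indicator fun _ => (1 : ℝ)) m :=
  (integrable_const 1).indicator hs

lemma condProb_mono {s t : Set Ω} (hs : MeasurableSet s) (ht : MeasurableSet t) (hst : s ⊆ t) :
    ∀ᵐ x ∂m, (m⟦s|𝒜⟧) x ≤ (m⟦t|𝒜⟧) x :=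
  condExp_mono (integrable_indicator_one hs) (integrable_indicator_one ht)
    (ae_of_all _ fun x => indicator_le_indicator_of_subset hst (fun _ => zero_le_one) x)

lemma condProb_le_one (h𝒜 : 𝒜 ≤ m0) {s : Set Ω} (hs : MeasurableSet s) :
    ∀ᵐ x ∂m, (m⟦s|𝒜⟧) x ≤ 1 := by
  filter_upwards [condProb_mono (𝒜 := 𝒜) (m := m) hs MeasurableSet.univ (subset_univ s)] with x hx
  rwa [indicator_univ, condExp_const h𝒜] at hx

/-- On `𝒜` the conditional probability is the density of `m` restricted to `s`. Working in `[0, ∞]`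
avoids any integrability assumption on `h`, which matters because `h = -log p` is unbounded. -/
lemma setLIntegral_eq_lintegral_condProb_mul (h𝒜 : 𝒜 ≤ m0) {s : Set Ω} (hs : MeasurableSet s)
    {h : Ω → ℝ≥0∞} (hh : Measurable[𝒜] h) :
    ∫⁻ x in s, h x ∂m = ∫⁻ x, ENNReal.ofReal ((m⟦s|𝒜⟧) x) * h x ∂m := by
  have hp : Measurable[𝒜] fun x => ENNReal.ofReal ((m⟦s|𝒜⟧) x) :=
    (stronglyMeasurable_condExp.measurable).ennreal_ofReal
  have key : (m.restrict s).trim h𝒜 =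
      (m.trim h𝒜).withDensity fun x => ENNReal.ofReal ((m⟦s|𝒜⟧) x) := by
    refine @Measure.ext _ 𝒜 _ _ fun t ht => ?_
    rw [trim_measurableSet_eq h𝒜 ht, withDensity_apply _ ht, restrict_trim h𝒜 _ ht,
      lintegral_trim h𝒜 hp, ← ofReal_integral_eq_lintegral_ofReal
        integrable_condExp.integrableOn (ae_restrict_of_ae (condProb_nonneg s)),
      setIntegral_condExp h𝒜 (integrable_indicator_one hs) ht, setIntegral_indicator hs,
      setIntegral_const, smul_eq_mul, mul_one, Measure.restrict_apply (h𝒜 _ ht), ofReal_measureReal]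
  rw [← lintegral_trim h𝒜 hh, key, lintegral_withDensity_eq_lintegral_mul _ hp hh,
    lintegral_trim h𝒜 (hp.mul hh)]
  rfl

/-- The set where the conditional probability is nonpositive is in `𝒜`, and testing against its
indicator shows that `s` gives it no mass. This permits splitting logarithms of products. -/
lemma ae_condProb_pos (h𝒜 : 𝒜 ≤ m0) {s : Set Ω} (hs : MeasurableSet s) :
    ∀ᵐ x ∂m, x ∈ s → 0 < (m⟦s|𝒜⟧) x := by
  have hZ : MeasurableSet[𝒜] {x | (m⟦s|𝒜⟧) x ≤ 0} :=
    (stronglyMeasurable_condExp (μ := m) (m := 𝒜)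
      (f := s.indicator fun _ => (1 : ℝ))).measurable measurableSet_Iic
  have h := setLIntegral_eq_lintegral_condProb_mul (m := m) h𝒜 hs
    (h := {x | (m⟦s|𝒜⟧) x ≤ 0}.indicator 1) ((measurable_const).indicator hZ)
  have h0 : ∫⁻ x, ENNReal.ofReal ((m⟦s|𝒜⟧) x) * {x | (m⟦s|𝒜⟧) x ≤ 0}.indicator 1 x ∂m = 0 := by
    rw [← lintegral_zero (μ := m)]
    congr with x
    by_cases hx : (m⟦s|𝒜⟧) x ≤ 0
    · rw [ENNReal.ofReal_of_nonpos hx, zero_mul]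
    · rw [indicator_of_notMem (by exact hx), mul_zero]
  rw [h0, lintegral_indicator_one (h𝒜 _ hZ), Measure.restrict_apply (h𝒜 _ hZ)] at h
  filter_upwards [measure_eq_zero_iff_ae_notMem.1 h] with x hx hxs
  by_contra! hle
  exact hx ⟨hle, hxs⟩

lemma Real.abs_negMulLog_le_one {p : ℝ} (h0 : 0 ≤ p) (h1 : p ≤ 1) : |Real.negMulLog p| ≤ 1 := by
  rw [abs_of_nonneg (Real.negMulLog_nonneg h0 h1)]
  rcases h0.eq_or_lt with rfl | hp
  · simp
  have := Real.one_sub_inv_le_log_of_pos hp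
  have h2 : p * (1 - p⁻¹) ≤ p * Real.log p := by gcongr
  rw [mul_sub, mul_inv_cancel₀ hp.ne'] at h2
  rw [Real.negMulLog]
  linarith

lemma integrable_negMulLog_condProb (h𝒜 : 𝒜 ≤ m0) {s : Set Ω} (hs : MeasurableSet s) :
    Integrable (fun x => Real.negMulLog ((m⟦s|𝒜⟧) x)) m := by
  refine Integrable.of_bound (C := 1) ?_ ?_
  · exact (Real.continuous_negMulLog.measurable.comp
      (stronglyMeasurable_condExp.mono h𝒜).measurable).aestronglyMeasurable
  · filter_upwards [condProb_nonneg (𝒜 := 𝒜) (m := m) s, condProb_le_one (m := m) h𝒜 hs] with x h0 h1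
    exact Real.abs_negMulLog_le_one h0 h1

/-- Trades the unbounded `-log p` on `s` for the bounded `-p log p` on the whole space, hence the
integrability of information. -/
lemma lintegral_neg_log_condProb (h𝒜 : 𝒜 ≤ m0) {s : Set Ω} (hs : MeasurableSet s) :
    ∫⁻ x in s, ENNReal.ofReal (-Real.log ((m⟦s|𝒜⟧) x)) ∂m =
      ∫⁻ x, ENNReal.ofReal (Real.negMulLog ((m⟦s|𝒜⟧) x)) ∂m := by
  rw [setLIntegral_eq_lintegral_condProb_mul h𝒜 hs]
  · refine lintegral_congr_ae ?_
    filter_upwards [condProb_nonneg (𝒜 := 𝒜) (m := m) s] with x h0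
    rw [← ENNReal.ofReal_mul h0, Real.negMulLog, mul_neg, neg_mul]
  · exact ((Real.measurable_log.comp stronglyMeasurable_condExp.measurable).neg).ennreal_ofReal

lemma ae_neg_log_condProb_nonneg (h𝒜 : 𝒜 ≤ m0) {s : Set Ω} (hs : MeasurableSet s) :
    ∀ᵐ x ∂m, 0 ≤ -Real.log ((m⟦s|𝒜⟧) x) := by
  filter_upwards [condProb_nonneg (𝒜 := 𝒜) (m := m) s, condProb_le_one (m := m) h𝒜 hs] with x h0 h1
  exact neg_nonneg.2 (Real.log_nonpos h0 h1)

lemma integrableOn_log_condProb (h𝒜 : 𝒜 ≤ m0) {s : Set Ω} (hs : MeasurableSet s) :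
    IntegrableOn (fun x => Real.log ((m⟦s|𝒜⟧) x)) s m := by
  rw [IntegrableOn, ← integrable_neg_iff]
  refine ⟨(Real.measurable_log.comp
      (stronglyMeasurable_condExp.mono h𝒜).measurable).neg.aestronglyMeasurable, ?_⟩
  change HasFiniteIntegral (fun x => -Real.log ((m⟦s|𝒜⟧) x)) (m.restrict s)
  rw [hasFiniteIntegral_iff_ofReal (ae_restrict_of_ae (ae_neg_log_condProb_nonneg h𝒜 hs))]
  have h := (integrable_negMulLog_condProb (m := m) h𝒜 hs).lintegral_lt_top
  rw [← lintegral_neg_log_condProb h𝒜 hs] at h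
  exact h

lemma setIntegral_log_condProb (h𝒜 : 𝒜 ≤ m0) {s : Set Ω} (hs : MeasurableSet s) :
    ∫ x in s, Real.log ((m⟦s|𝒜⟧) x) ∂m = -∫ x, Real.negMulLog ((m⟦s|𝒜⟧) x) ∂m := by
  rw [← neg_inj, neg_neg, ← integral_neg]
  rw [integral_eq_lintegral_of_nonneg_ae (ae_restrict_of_ae (ae_neg_log_condProb_nonneg h𝒜 hs))
    (integrableOn_log_condProb h𝒜 hs).neg.aestronglyMeasurable, lintegral_neg_log_condProb h𝒜 hs,
    integral_eq_lintegral_of_nonneg_ae _ (integrable_negMulLog_condProb h𝒜 hs).aestronglyMeasurable]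
  filter_upwards [condProb_nonneg (𝒜 := 𝒜) (m := m) s, condProb_le_one (m := m) h𝒜 hs] with x h0 h1
  exact Real.negMulLog_nonneg h0 h1

end CondProb

/-! ### Conditional entropy of finite-valued variables: chain rule, counting bound, invariance. -/

section FinEntropy

variable {Ω ι κ : Type*}

/-- The conditional entropy given `𝒜` of a random variable with values in a finite type. -/
noncomputable def finEntropy (𝒜 : MeasurableSpace Ω) [MeasurableSpace Ω] (m : Measure Ω) [Fintype ι]
    (f : Ω → ι) : ℝ :=
  ∑ i, ∫ x, Real.negMulLog ((m⟦f ⁻¹' {i}|𝒜⟧) x) ∂m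

section General

variable {𝒜 m0 : MeasurableSpace Ω} {m : Measure Ω}

lemma condInformation_eq_sum {A : ι → Set Ω} {s : Finset ι} (hs : ∀ i ∉ s, A i = ∅) (x : Ω) :
    condInformation 𝒜 m A x =
      -∑ i ∈ s, (A i).indicator (fun y => Real.log ((m⟦A i|𝒜⟧) y)) x := by
  rw [condInformation, tsum_eq_sum (s := s) fun i hi => by rw [hs i hi]; simp]
  congr 1
  refine Finset.sum_congr rfl fun i _ => ?_
  by_cases hx : x ∈ A i <;> simp [hx]

lemma finEntropy_comp_equiv [Fintype ι] [Fintype κ] (e : ι ≃ κ) (f : Ω → ι) :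
    finEntropy 𝒜 m (fun x => e (f x)) = finEntropy 𝒜 m f := by
  rw [finEntropy, ← e.sum_comp]
  refine Finset.sum_congr rfl fun i _ => ?_
  have : (fun x => e (f x)) ⁻¹' {e i} = f ⁻¹' {i} := by ext x; simp
  rw [this]

lemma setIntegral_eq_sum_fiber [Fintype ι] [MeasurableSpace ι] [MeasurableSingletonClass ι]
    {f : Ω → ι} (hf : Measurable f) {t : Set Ω} (ht : MeasurableSet t)
    {h : Ω → ℝ} (hh : IntegrableOn h t m) :
    ∫ x in t, h x ∂m = ∑ i, ∫ x in f ⁻¹' {i} ∩ t, h x ∂m := by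
  have hcover : t = ⋃ i, f ⁻¹' {i} ∩ t := by
    ext x
    simp
  conv_lhs => rw [hcover]
  refine integral_iUnion_fintype (fun i => (hf (measurableSet_singleton i)).inter ht) ?_ ?_
  · intro i j hij
    refine Set.disjoint_left.2 fun x hx hx' => hij ?_
    exact (show f x = i from hx.1).symm.trans (show f x = j from hx'.1)
  · exact fun i => hh.mono_set inter_subset_right

/-- This is `log t ≤ t - 1` at `t = 1/(pC)`. Summed over at most `C` values of total mass one, it
bounds an entropy by `log C`. -/
lemma negMulLog_le_mul_log_add {p C : ℝ} (hp : 0 ≤ p) (hC : 0 < C) :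
    Real.negMulLog p ≤ p * Real.log C + (C⁻¹ - p) := by
  rcases hp.eq_or_lt with rfl | hp
  · simp [hC.le]
  have h := Real.log_le_sub_one_of_pos (inv_pos.2 (mul_pos hp hC))
  rw [Real.log_inv, Real.log_mul hp.ne' hC.ne'] at h
  have h2 := mul_le_mul_of_nonneg_left h hp.le
  have h3 : p * ((p * C)⁻¹ - 1) = C⁻¹ - p := by field_simp
  rw [h3] at h2
  rw [Real.negMulLog]
  linarith

variable [IsProbabilityMeasure m]

lemma finEntropy_bot [Fintype ι] (f : Ω → ι) :
    finEntropy ⊥ m f = ∑ i, Real.negMulLog (∫ x, (f ⁻¹' {i}).indicator (fun _ => (1 : ℝ)) x ∂m) := by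
  simp [finEntropy, condExp_bot]

lemma integrable_condInformation (h𝒜 : 𝒜 ≤ m0) {A : ι → Set Ω} {s : Finset ι}
    (hs : ∀ i ∉ s, A i = ∅) (hA : ∀ i, MeasurableSet (A i)) :
    Integrable (condInformation 𝒜 m A) m := by
  rw [funext (condInformation_eq_sum hs)]
  exact (integrable_finsetSum _ fun i _ =>
    (integrableOn_log_condProb h𝒜 (hA i)).integrable_indicator (hA i)).neg

lemma condEntropy_eq_sum (h𝒜 : 𝒜 ≤ m0) {A : ι → Set Ω} {s : Finset ι}
    (hs : ∀ i ∉ s, A i = ∅) (hA : ∀ i, MeasurableSet (A i)) :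
    condEntropy 𝒜 m A = ∑ i ∈ s, ∫ x, Real.negMulLog ((m⟦A i|𝒜⟧) x) ∂m := by
  rw [condEntropy, funext (condInformation_eq_sum hs), integral_neg, integral_finsetSum _ fun i _ =>
    (integrableOn_log_condProb h𝒜 (hA i)).integrable_indicator (hA i), ← Finset.sum_neg_distrib]
  refine Finset.sum_congr rfl fun i _ => ?_
  rw [integral_indicator (hA i), setIntegral_log_condProb h𝒜 (hA i), neg_neg]

/-- On a single fibre of `f`, adjoining `f` to `𝒜` creates no new sets: the sets `B` with this
property form a σ-algebra that contains `𝒜` and all preimages under `f`. -/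
lemma exists_inter_eq_of_measurableSet_sup_comap [MeasurableSpace ι] {f : Ω → ι} {B : Set Ω}
    (hB : MeasurableSet[𝒜 ⊔ MeasurableSpace.comap f inferInstance] B) (i : ι) :
    ∃ C, MeasurableSet[𝒜] C ∧ B ∩ f ⁻¹' {i} = C ∩ f ⁻¹' {i} := by
  let ℳ : MeasurableSpace Ω :=
    { MeasurableSet' := fun B => ∃ C, MeasurableSet[𝒜] C ∧ B ∩ f ⁻¹' {i} = C ∩ f ⁻¹' {i}
      measurableSet_empty := ⟨∅, MeasurableSet.empty, rfl⟩
      measurableSet_compl := by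
        rintro B ⟨C, hC, hBC⟩
        refine ⟨Cᶜ, hC.compl, ?_⟩
        ext x
        have := Set.ext_iff.1 hBC x
        simp only [mem_inter_iff, mem_compl_iff] at this ⊢
        tauto
      measurableSet_iUnion := by
        intro B hB
        choose C hC hBC using hB
        refine ⟨⋃ n, C n, MeasurableSet.iUnion hC, ?_⟩
        rw [iUnion_inter, iUnion_inter]
        exact iUnion_congr hBC }
  refine (sup_le ?_ ?_ : 𝒜 ⊔ MeasurableSpace.comap f inferInstance ≤ ℳ) B hB
  · exact fun C hC => ⟨C, hC, rfl⟩
  · rintro _ ⟨t, -, rfl⟩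
    by_cases hi : i ∈ t
    · refine ⟨univ, @MeasurableSet.univ _ 𝒜, ?_⟩
      ext x
      simp only [mem_inter_iff, mem_preimage, mem_singleton_iff, mem_univ, true_and]
      exact ⟨fun h => h.2, fun h => ⟨h ▸ hi, h⟩⟩
    · refine ⟨∅, @MeasurableSet.empty _ 𝒜, ?_⟩
      ext x
      simp only [mem_inter_iff, mem_preimage, mem_singleton_iff, mem_empty_iff_false, false_and,
        iff_false, not_and]
      exact fun h h' => hi (h' ▸ h)

lemma setIntegral_inter_eq_setIntegral_condProb_mul (h𝒜 : 𝒜 ≤ m0) {C t : Set Ω} {h : Ω → ℝ}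
    (hC : MeasurableSet[𝒜] C) (ht : MeasurableSet t) (hh : StronglyMeasurable[𝒜] h)
    (hb : ∀ᵐ x ∂m, ‖h x‖ ≤ 1) :
    ∫ x in C ∩ t, h x ∂m = ∫ x in C, (m⟦t|𝒜⟧) x * h x ∂m := by
  have h1 := condExp_stronglyMeasurable_mul_of_bound h𝒜 hh
    (integrable_indicator_one (m := m) ht) 1 hb
  have hint : Integrable (h * t.indicator fun _ => (1 : ℝ)) m :=
    (integrable_indicator_one ht).bdd_mul (hh.mono h𝒜).aestronglyMeasurable hb
  have h2 := setIntegral_condExp h𝒜 hint hC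
  rw [setIntegral_congr_ae (g := h * m⟦t|𝒜⟧) (h𝒜 _ hC) (h1.mono fun x hx _ => hx)] at h2
  simp only [Pi.mul_apply, mul_comm (h _)] at h2
  rw [h2, ← setIntegral_indicator ht]
  congr with x
  by_cases hx : x ∈ t <;> simp [hx]

lemma ae_norm_condProb_le_one (h𝒜 : 𝒜 ≤ m0) {s : Set Ω} (hs : MeasurableSet s) :
    ∀ᵐ x ∂m, ‖(m⟦s|𝒜⟧) x‖ ≤ 1 := by
  filter_upwards [condProb_nonneg (𝒜 := 𝒜) (m := m) s, condProb_le_one (m := m) h𝒜 hs] with x h0 h1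
  rwa [Real.norm_of_nonneg h0]

/-- Bayes' formula, in product form to avoid division. Over a set of the joined σ-algebra, which on
the fibre `s` may be replaced by some `C ∈ 𝒜`, both sides integrate to the integral over `C` of the
product of the conditional probabilities of `s` and `s ∩ t` given `𝒜`. -/
lemma condProb_sup_comap_mul [MeasurableSpace ι] [MeasurableSingletonClass ι] (h𝒜 : 𝒜 ≤ m0)
    {f : Ω → ι} (hf : Measurable f) {t : Set Ω} (ht : MeasurableSet t) (i : ι) :
    ∀ᵐ x ∂m, x ∈ f ⁻¹' {i} →
      (m⟦t|𝒜 ⊔ MeasurableSpace.comap f inferInstance⟧) x * (m⟦f ⁻¹' {i}|𝒜⟧) x =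
        (m⟦f ⁻¹' {i} ∩ t|𝒜⟧) x := by
  set ℬ := 𝒜 ⊔ MeasurableSpace.comap f inferInstance with hℬ
  set s := f ⁻¹' {i} with hs_def
  have h𝒜ℬ : 𝒜 ≤ ℬ := le_sup_left
  have hℬm : ℬ ≤ m0 := sup_le h𝒜 hf.comap_le
  have hsℬ : MeasurableSet[ℬ] s :=
    (le_sup_right : _ ≤ ℬ) _ ⟨{i}, measurableSet_singleton i, rfl⟩
  have hs : MeasurableSet[m0] s := hℬm _ hsℬ
  have hp := ae_norm_condProb_le_one (m := m) h𝒜 hs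
  have hr := ae_norm_condProb_le_one (m := m) h𝒜 (hs.inter ht)
  have hUint : Integrable (s.indicator fun x => (m⟦t|ℬ⟧) x * (m⟦s|𝒜⟧) x) m :=
    (Integrable.mul_bdd integrable_condExp
      (stronglyMeasurable_condExp.mono h𝒜).aestronglyMeasurable hp).indicator hs
  have hVint : Integrable (s.indicator fun x => (m⟦s ∩ t|𝒜⟧) x) m := integrable_condExp.indicator hs
  have key : s.indicator (fun x => (m⟦t|ℬ⟧) x * (m⟦s|𝒜⟧) x) =ᵐ[m]
      s.indicator fun x => (m⟦s ∩ t|𝒜⟧) x := by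
    refine ae_eq_of_forall_setIntegral_eq_of_sigmaFinite' hℬm (fun _ _ _ => hUint.integrableOn)
      (fun _ _ _ => hVint.integrableOn) (fun B hB _ => ?_) ?_ ?_
    · obtain ⟨C, hC, hBC⟩ := exists_inter_eq_of_measurableSet_sup_comap hB i
      rw [setIntegral_indicator hs, setIntegral_indicator hs, hBC,
        ← setIntegral_inter_eq_setIntegral_condProb_mul hℬm (MeasurableSet.inter (h𝒜ℬ _ hC) hsℬ) ht
          (stronglyMeasurable_condExp.mono h𝒜ℬ) hp,
        setIntegral_inter_eq_setIntegral_condProb_mul h𝒜 hC hs stronglyMeasurable_condExp hr,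
        inter_assoc, setIntegral_inter_eq_setIntegral_condProb_mul h𝒜 hC (hs.inter ht)
          stronglyMeasurable_condExp hp]
      simp only [mul_comm]
    · exact ((stronglyMeasurable_condExp.mul
        (stronglyMeasurable_condExp.mono h𝒜ℬ)).indicator hsℬ).aestronglyMeasurable
    · exact ((stronglyMeasurable_condExp.mono h𝒜ℬ).indicator hsℬ).aestronglyMeasurable
  filter_upwards [key] with x hx hxs
  rwa [indicator_of_mem hxs, indicator_of_mem hxs] at hx

lemma finEntropy_nonneg (h𝒜 : 𝒜 ≤ m0) [Fintype ι] {f : Ω → ι}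
    (hf : ∀ i, MeasurableSet (f ⁻¹' {i})) : 0 ≤ finEntropy 𝒜 m f := by
  refine Finset.sum_nonneg fun i _ => integral_nonneg_of_ae ?_
  filter_upwards [condProb_nonneg (𝒜 := 𝒜) (m := m) (f ⁻¹' {i}),
    condProb_le_one (m := m) h𝒜 (hf i)] with x h0 h1
  exact Real.negMulLog_nonneg h0 h1

variable [Fintype ι] [MeasurableSpace ι] [MeasurableSingletonClass ι]
  [Fintype κ] [MeasurableSpace κ] [MeasurableSingletonClass κ]

/-- The chain rule: the logarithm of Bayes' formula, integrated over each cell `{f = i, g = j}` and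
summed. -/
theorem finEntropy_prod (h𝒜 : 𝒜 ≤ m0) {f : Ω → ι} (hf : Measurable f) {g : Ω → κ}
    (hg : Measurable g) :
    finEntropy 𝒜 m (fun x => (f x, g x)) =
      finEntropy 𝒜 m f + finEntropy (𝒜 ⊔ MeasurableSpace.comap f inferInstance) m g := by
  set ℬ := 𝒜 ⊔ MeasurableSpace.comap f inferInstance with hℬ
  have hℬm : ℬ ≤ m0 := sup_le h𝒜 hf.comap_le
  have hs : ∀ i, MeasurableSet[m0] (f ⁻¹' {i}) := fun i => hf (measurableSet_singleton i)
  have ht : ∀ j, MeasurableSet[m0] (g ⁻¹' {j}) := fun j => hg (measurableSet_singleton j)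
  have hst : ∀ i j, (fun x => (f x, g x)) ⁻¹' {(i, j)} = f ⁻¹' {i} ∩ g ⁻¹' {j} := by
    intro i j
    ext x
    simp
  have hp : ∀ i, ∫ x, Real.negMulLog ((m⟦f ⁻¹' {i}|𝒜⟧) x) ∂m =
      -∑ j, ∫ x in f ⁻¹' {i} ∩ g ⁻¹' {j}, Real.log ((m⟦f ⁻¹' {i}|𝒜⟧) x) ∂m := by
    intro i
    rw [← neg_inj, neg_neg, ← setIntegral_log_condProb h𝒜 (hs i),
      setIntegral_eq_sum_fiber hg (hs i) (integrableOn_log_condProb h𝒜 (hs i))]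
    simp only [inter_comm]
  have hT : ∀ j, ∫ x, Real.negMulLog ((m⟦g ⁻¹' {j}|ℬ⟧) x) ∂m =
      -∑ i, ∫ x in f ⁻¹' {i} ∩ g ⁻¹' {j}, Real.log ((m⟦g ⁻¹' {j}|ℬ⟧) x) ∂m := by
    intro j
    rw [← neg_inj, neg_neg, ← setIntegral_log_condProb hℬm (ht j),
      setIntegral_eq_sum_fiber hf (ht j) (integrableOn_log_condProb hℬm (ht j))]
  have hr : ∀ i j, ∫ x, Real.negMulLog ((m⟦f ⁻¹' {i} ∩ g ⁻¹' {j}|𝒜⟧) x) ∂m =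
      -(∫ x in f ⁻¹' {i} ∩ g ⁻¹' {j}, Real.log ((m⟦f ⁻¹' {i}|𝒜⟧) x) ∂m) -
        ∫ x in f ⁻¹' {i} ∩ g ⁻¹' {j}, Real.log ((m⟦g ⁻¹' {j}|ℬ⟧) x) ∂m := by
    intro i j
    rw [← neg_inj, ← setIntegral_log_condProb h𝒜 ((hs i).inter (ht j)), neg_sub, sub_neg_eq_add,
      ← integral_add ((integrableOn_log_condProb hℬm (ht j)).mono_set inter_subset_right)
        ((integrableOn_log_condProb h𝒜 (hs i)).mono_set inter_subset_left)]
    refine setIntegral_congr_ae ((hs i).inter (ht j)) ?_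
    filter_upwards [condProb_sup_comap_mul (m := m) h𝒜 hf (ht j) i, ae_condProb_pos (m := m) h𝒜 (hs i),
      ae_condProb_pos (m := m) hℬm (ht j)] with x h1 h2 h3 hx
    rw [← h1 hx.1, Real.log_mul (h3 hx.2).ne' (h2 hx.1).ne']
  simp only [finEntropy, Fintype.sum_prod_type, hst, hr, hp, hT, Finset.sum_sub_distrib,
    Finset.sum_neg_distrib]
  rw [Finset.sum_comm (f := fun i j => ∫ x in f ⁻¹' {i} ∩ g ⁻¹' {j}, Real.log ((m⟦g ⁻¹' {j}|ℬ⟧) x) ∂m)]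
  ring

theorem finEntropy_prod' (h𝒜 : 𝒜 ≤ m0) {f : Ω → ι} (hf : Measurable f) {g : Ω → κ}
    (hg : Measurable g) :
    finEntropy 𝒜 m (fun x => (f x, g x)) =
      finEntropy 𝒜 m g + finEntropy (𝒜 ⊔ MeasurableSpace.comap g inferInstance) m f := by
  rw [← finEntropy_prod h𝒜 hg hf]
  exact (finEntropy_comp_equiv (Equiv.prodComm κ ι) fun x => (g x, f x))

/-- A variable that takes at most `C` values once the `𝒜`-measurable variable `g` is known has
conditional entropy at most `log C`. -/
theorem finEntropy_le_log {τ : Type*} [Countable τ] [MeasurableSpace τ] [MeasurableSingletonClass τ]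
    (h𝒜 : 𝒜 ≤ m0) {f : Ω → ι} (hf : Measurable f) {g : Ω → τ} (hg : Measurable[𝒜] g) {C : ℕ}
    (hC0 : 0 < C) (hC : ∀ j, {i | ∃ x, f x = i ∧ g x = j}.ncard ≤ C) :
    finEntropy 𝒜 m f ≤ Real.log C := by
  classical
  have hs : ∀ i, MeasurableSet[m0] (f ⁻¹' {i}) := fun i => hf (measurableSet_singleton i)
  -- If `i` is not attained on `{g = j}`, then `{f = i}` lies in the `𝒜`-measurable complement of
  -- that cell, so its conditional probability vanishes on the cell. Countability of `τ` lets these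
  -- null sets be collected.
  have hzero : ∀ j i, ∀ᵐ x ∂m, g x = j → (¬ ∃ y, f y = i ∧ g y = j) →
      (m⟦f ⁻¹' {i}|𝒜⟧) x ≤ 0 := by
    intro j i
    have hZ : MeasurableSet[𝒜] (g ⁻¹' {j})ᶜ := (hg (measurableSet_singleton j)).compl
    by_cases hex : ∃ y, f y = i ∧ g y = j
    · exact ae_of_all _ fun x _ h => absurd hex h
    filter_upwards [condProb_mono (𝒜 := 𝒜) (m := m) (s := f ⁻¹' {i}) (t := (g ⁻¹' {j})ᶜ) (hs i)
      (h𝒜 _ hZ) fun y hy hy' => hex ⟨y, hy, hy'⟩] with x hx hxj _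
    rw [condExp_of_stronglyMeasurable h𝒜 (stronglyMeasurable_const.indicator hZ)
      (integrable_indicator_one (h𝒜 _ hZ))] at hx
    rwa [indicator_of_notMem (by simpa using hxj)] at hx
  have hsum : ∀ᵐ x ∂m, ∑ i, (m⟦f ⁻¹' {i}|𝒜⟧) x = 1 := by
    have h1 := condExp_finsetSum (μ := m) (s := Finset.univ)
      (f := fun i => (f ⁻¹' {i}).indicator fun _ => (1 : ℝ))
      (fun i _ => integrable_indicator_one (hs i)) 𝒜
    have h2 : (∑ i, (f ⁻¹' {i}).indicator fun _ => (1 : ℝ)) = fun _ => 1 := by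
      funext x
      simp [Finset.sum_apply, indicator_apply]
    rw [h2, condExp_const h𝒜] at h1
    filter_upwards [h1] with x hx
    rw [Finset.sum_apply] at hx
    exact hx.symm
  have hbound : ∀ᵐ x ∂m, ∑ i, Real.negMulLog ((m⟦f ⁻¹' {i}|𝒜⟧) x) ≤ Real.log C := by
    filter_upwards [ae_all_iff.2 fun j => ae_all_iff.2 (hzero j), hsum,
      ae_all_iff.2 fun i => condProb_nonneg (𝒜 := 𝒜) (m := m) (f ⁻¹' {i})] with x h0 h1 h2
    set T : Finset ι := Finset.univ.filter fun i => ∃ y, f y = i ∧ g y = g x with hT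
    have hTC : T.card ≤ C := by
      have := hC (g x)
      rwa [Set.ncard_eq_toFinset_card', toFinset_ofPred] at this
    have hout : ∀ i ∉ T, (m⟦f ⁻¹' {i}|𝒜⟧) x = 0 := by
      intro i hi
      refine le_antisymm (h0 (g x) i rfl ?_) (h2 i)
      simpa [hT] using hi
    have hC' : (0 : ℝ) < C := by exact_mod_cast hC0
    rw [← Finset.sum_subset (Finset.subset_univ T) fun i _ hi => by rw [hout i hi, Real.negMulLog_zero]]
    rw [← Finset.sum_subset (Finset.subset_univ T) fun i _ hi => hout i hi] at h1
    calc ∑ i ∈ T, Real.negMulLog ((m⟦f ⁻¹' {i}|𝒜⟧) x)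
        ≤ ∑ i ∈ T, ((m⟦f ⁻¹' {i}|𝒜⟧) x * Real.log C + ((C : ℝ)⁻¹ - (m⟦f ⁻¹' {i}|𝒜⟧) x)) :=
          Finset.sum_le_sum fun i _ => negMulLog_le_mul_log_add (h2 i) hC'
      _ = Real.log C + (T.card * (C : ℝ)⁻¹ - 1) := by
          rw [Finset.sum_add_distrib, ← Finset.sum_mul, Finset.sum_sub_distrib, h1, one_mul,
            Finset.sum_const, nsmul_eq_mul]
      _ ≤ Real.log C := by
          have : (T.card : ℝ) * (C : ℝ)⁻¹ ≤ 1 := by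
            rw [← div_eq_mul_inv, div_le_one hC']
            exact_mod_cast hTC
          linarith
  rw [finEntropy, ← integral_finsetSum _ fun i _ => integrable_negMulLog_condProb h𝒜 (hs i)]
  refine (integral_mono_ae (integrable_finsetSum _ fun i _ => integrable_negMulLog_condProb h𝒜 (hs i))
    (integrable_const _) hbound).trans ?_
  simp

lemma finEntropy_le_log_card [Nonempty ι] (h𝒜 : 𝒜 ≤ m0) {f : Ω → ι} (hf : Measurable f) :
    finEntropy 𝒜 m f ≤ Real.log (Fintype.card ι) := by
  refine finEntropy_le_log h𝒜 hf (g := fun _ => ()) measurable_const Fintype.card_pos fun j => ?_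
  rw [← Nat.card_eq_fintype_card]
  exact Set.ncard_le_card _

end General

section Invariance

variable {𝒜 m0 : MeasurableSpace Ω} {m : Measure Ω} [IsProbabilityMeasure m]

/-- With `finEntropy_comp_measurePreserving`, this says that an invariant measure cannot distinguish
`(f, 𝒜)` from `(f ∘ T, T⁻¹𝒜)`. -/
lemma condExp_comp_measurePreserving (h𝒜 : 𝒜 ≤ m0) {T : Ω → Ω}
    (hT : MeasurePreserving T m m) {h : Ω → ℝ} (hh : Integrable h m) :
    (fun x => (m[h|𝒜]) (T x)) =ᵐ[m] m[fun x => h (T x)|𝒜.comap T] := by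
  have hle : 𝒜.comap T ≤ m0 := (MeasurableSpace.comap_mono h𝒜).trans hT.measurable.comap_le
  have hcomp : ∀ {F : Ω → ℝ}, Integrable F m → ∀ t, MeasurableSet t →
      ∫ x in T ⁻¹' t, F (T x) ∂m = ∫ x in t, F x ∂m := by
    intro F hF t ht
    conv_rhs => rw [← hT.map_eq]
    rw [setIntegral_map ht (by rw [hT.map_eq]; exact hF.aestronglyMeasurable) hT.measurable.aemeasurable]
  refine ae_eq_condExp_of_forall_setIntegral_eq hle (hT.integrable_comp_of_integrable hh) ?_ ?_ ?_
  · exact fun _ _ _ => (hT.integrable_comp_of_integrable integrable_condExp).integrableOn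
  · rintro _ ⟨t, ht, rfl⟩ -
    rw [hcomp integrable_condExp t (h𝒜 _ ht), hcomp hh t (h𝒜 _ ht), setIntegral_condExp h𝒜 hh ht]
  · refine StronglyMeasurable.aestronglyMeasurable ?_
    exact (stronglyMeasurable_condExp (m := 𝒜)).comp_measurable (comap_measurable T)

theorem finEntropy_comp_measurePreserving (h𝒜 : 𝒜 ≤ m0) {T : Ω → Ω}
    (hT : MeasurePreserving T m m) [Fintype ι] {f : Ω → ι} (hf : ∀ i, MeasurableSet (f ⁻¹' {i})) :
    finEntropy (𝒜.comap T) m (fun x => f (T x)) = finEntropy 𝒜 m f := by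
  refine Finset.sum_congr rfl fun i _ => ?_
  have h1 := condExp_comp_measurePreserving h𝒜 hT (integrable_indicator_one (m := m) (hf i))
  have h2 : ∫ x, Real.negMulLog ((m⟦f ⁻¹' {i}|𝒜⟧) x) ∂m =
      ∫ x, Real.negMulLog ((m⟦f ⁻¹' {i}|𝒜⟧) (T x)) ∂m := by
    conv_lhs => rw [← hT.map_eq]
    rw [integral_map hT.measurable.aemeasurable]
    · rw [hT.map_eq]
    · rw [hT.map_eq]
      exact (integrable_negMulLog_condProb h𝒜 (hf i)).aestronglyMeasurable
  rw [h2]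
  refine integral_congr_ae ?_
  filter_upwards [h1] with x hx
  rw [hx]
  rfl

end Invariance

end FinEntropy

/-! ### Continuity of conditional entropy along partitions with shrinking cells. -/

section Convergence

variable {Ω ι E : Type*} {𝒢 ℋ m0 : MeasurableSpace Ω} {m : Measure Ω} [IsProbabilityMeasure m]

/-- Conditional expectation contracts `L¹` and fixes `s`, so `u` is at most twice as far from its
projection as from any `𝒢`-measurable `s`. -/
lemma integral_abs_condExp_sub_le (h𝒢 : 𝒢 ≤ m0) {u s : Ω → ℝ} (hu : Integrable u m)
    (hs : StronglyMeasurable[𝒢] s) (hs' : Integrable s m) :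
    ∫ x, |(m[u|𝒢]) x - u x| ∂m ≤ 2 * ∫ x, |u x - s x| ∂m := by
  have h1 : ∫ x, |(m[u - s|𝒢]) x| ∂m ≤ ∫ x, |u x - s x| ∂m := integral_abs_condExp_le (u - s)
  have h2 : ∀ᵐ x ∂m, |(m[u|𝒢]) x - u x| ≤ |(m[u - s|𝒢]) x| + |u x - s x| := by
    filter_upwards [condExp_sub hu hs' 𝒢] with x hx
    rw [hx, Pi.sub_apply, condExp_of_stronglyMeasurable h𝒢 hs hs', abs_sub_comm (u x)]
    refine le_trans (le_of_eq ?_) (abs_add_le _ _)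
    congr 1
    ring
  calc ∫ x, |(m[u|𝒢]) x - u x| ∂m ≤ ∫ x, (|(m[u - s|𝒢]) x| + |u x - s x|) ∂m :=
        integral_mono_ae (integrable_condExp.sub hu).abs
          (integrable_condExp.abs.add (hu.sub hs').abs) h2
    _ = (∫ x, |(m[u - s|𝒢]) x| ∂m) + ∫ x, |u x - s x| ∂m :=
        integral_add integrable_condExp.abs (hu.sub hs').abs
    _ ≤ 2 * ∫ x, |u x - s x| ∂m := by linarith

/-- `negMulLog` is not Lipschitz at `0`. Uniform continuity handles `|a - b| < δ`; otherwise the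
trivial bound `2` is at most `(2/δ)|a - b|`. This form converts `L¹` convergence of probabilities
into convergence of entropies. -/
lemma exists_abs_negMulLog_sub_le {ε : ℝ} (hε : 0 < ε) :
    ∃ C : ℝ, 0 ≤ C ∧ ∀ a ∈ Icc (0 : ℝ) 1, ∀ b ∈ Icc (0 : ℝ) 1,
      |Real.negMulLog a - Real.negMulLog b| ≤ ε + C * |a - b| := by
  have huc : UniformContinuousOn Real.negMulLog (Icc 0 1) :=
    isCompact_Icc.uniformContinuousOn_of_continuous Real.continuous_negMulLog.continuousOn
  obtain ⟨δ, hδ, h⟩ := Metric.uniformContinuousOn_iff.1 huc ε hε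
  refine ⟨2 / δ, by positivity, fun a ha b hb => ?_⟩
  rcases lt_or_ge |a - b| δ with hab | hab
  · have := h a ha b hb hab
    rw [Real.dist_eq] at this
    have h2 : 0 ≤ 2 / δ * |a - b| := by positivity
    linarith
  · have h1 : 2 ≤ 2 / δ * |a - b| := by
      rw [div_mul_eq_mul_div, le_div_iff₀ hδ]
      gcongr
    have h2 := abs_sub (Real.negMulLog a) (Real.negMulLog b)
    have h3 := Real.abs_negMulLog_le_one ha.1 ha.2
    have h4 := Real.abs_negMulLog_le_one hb.1 hb.2
    linarith

lemma tendsto_integral_negMulLog_condProb {𝒢 : ℕ → MeasurableSpace Ω} (h𝒢 : ∀ n, 𝒢 n ≤ m0)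
    (hℋ : ℋ ≤ m0) {s : Set Ω} (hs : MeasurableSet s)
    (h : Tendsto (fun n => ∫ x, |(m⟦s|𝒢 n⟧) x - (m⟦s|ℋ⟧) x| ∂m) atTop (𝓝 0)) :
    Tendsto (fun n => ∫ x, Real.negMulLog ((m⟦s|𝒢 n⟧) x) ∂m) atTop
      (𝓝 (∫ x, Real.negMulLog ((m⟦s|ℋ⟧) x) ∂m)) := by
  rw [Metric.tendsto_atTop']
  intro ε hε
  obtain ⟨C, hC0, hC⟩ := exists_abs_negMulLog_sub_le (half_pos hε)
  have h' : Tendsto (fun n => ε / 2 + C * ∫ x, |(m⟦s|𝒢 n⟧) x - (m⟦s|ℋ⟧) x| ∂m) atTop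
      (𝓝 (ε / 2)) := by simpa using (h.const_mul C).const_add (ε / 2)
  obtain ⟨N, hN⟩ := eventually_atTop.1 (h'.eventually (gt_mem_nhds (half_lt_self hε)))
  refine ⟨N, fun n hn => lt_of_le_of_lt ?_ (hN n hn.le)⟩
  have hmem : ∀ {ℱ : MeasurableSpace Ω}, ℱ ≤ m0 → ∀ᵐ x ∂m, (m⟦s|ℱ⟧) x ∈ Icc (0 : ℝ) 1 := by
    intro ℱ hℱ
    filter_upwards [condProb_nonneg (𝒜 := ℱ) (m := m) s, condProb_le_one (m := m) hℱ hs]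
      with x h0 h1 using ⟨h0, h1⟩
  rw [Real.dist_eq, ← integral_sub (integrable_negMulLog_condProb (h𝒢 n) hs)
    (integrable_negMulLog_condProb hℋ hs)]
  refine abs_integral_le_integral_abs.trans ?_
  have hi : Integrable (fun x => |(m⟦s|𝒢 n⟧) x - (m⟦s|ℋ⟧) x|) m :=
    (integrable_condExp.sub integrable_condExp).abs
  calc ∫ x, |Real.negMulLog ((m⟦s|𝒢 n⟧) x) - Real.negMulLog ((m⟦s|ℋ⟧) x)| ∂m
      ≤ ∫ x, (ε / 2 + C * |(m⟦s|𝒢 n⟧) x - (m⟦s|ℋ⟧) x|) ∂m := by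
        refine integral_mono_ae ((integrable_negMulLog_condProb (h𝒢 n) hs).sub
          (integrable_negMulLog_condProb hℋ hs)).abs ((integrable_const _).add (hi.const_mul C)) ?_
        filter_upwards [hmem (h𝒢 n), hmem hℋ] with x h1 h2 using hC _ h1 _ h2
    _ = ε / 2 + C * ∫ x, |(m⟦s|𝒢 n⟧) x - (m⟦s|ℋ⟧) x| ∂m := by
        rw [integral_add (integrable_const _) (hi.const_mul C), integral_const_mul]
        simp

variable [MetricSpace E] [ProperSpace E] [MeasurableSpace E] [BorelSpace E]
  {τ : ℕ → Type*} [∀ n, Countable (τ n)] [∀ n, MeasurableSpace (τ n)]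
  [∀ n, MeasurableSingletonClass (τ n)]

/-- The partitions `A^n 𝒬` need not be nested, so martingale convergence is not used. Instead `E(h |
p) = φ ∘ p`, and `φ` is close in `L¹` to a uniformly continuous `ψ`, for which `ψ ∘ p` is almost
constant on small cells. -/
lemma tendsto_integral_abs_condExp_sub {p : Ω → E} (hp : Measurable p) {g : ∀ n, Ω → τ n}
    (hg : ∀ n, Measurable[MeasurableSpace.comap p inferInstance] (g n))
    (hdiam : ∀ ε > 0, ∀ᶠ n in atTop, ∀ x y, g n x = g n y → dist (p x) (p y) < ε) (h : Ω → ℝ) :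
    Tendsto (fun n => ∫ x, |(m[h|MeasurableSpace.comap (g n) inferInstance]) x -
      (m[h|MeasurableSpace.comap p inferInstance]) x| ∂m) atTop (𝓝 0) := by
  obtain ⟨ν, hν⟩ : ∃ ν, ν = m.map p := ⟨_, rfl⟩
  have hνp : IsProbabilityMeasure ν := hν ▸ Measure.isProbabilityMeasure_map hp.aemeasurable
  set Γ : MeasurableSpace Ω := MeasurableSpace.comap p inferInstance with hΓ
  have hΓm : Γ ≤ m0 := hp.comap_le
  have h𝒢Γ : ∀ n, MeasurableSpace.comap (g n) inferInstance ≤ Γ := fun n => (hg n).comap_le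
  obtain ⟨φ, hφ, hu⟩ := (stronglyMeasurable_condExp (μ := m) (m := Γ)
    (f := h)).exists_eq_measurable_comp
  have hφi : Integrable φ ν := by
    rw [hν, integrable_map_measure hφ.aestronglyMeasurable hp.aemeasurable, ← hu]
    exact integrable_condExp
  rw [Metric.tendsto_atTop']
  intro ε hε
  -- One `ε/8` pays for replacing `φ` by `ψ`, another for the oscillation of `ψ` on a cell. The
  -- factor `2` of `integral_abs_condExp_sub_le` turns the sum into `ε/2`.
  obtain ⟨ψ, hψc, hψ, hψcont, hψi⟩ := hφi.exists_hasCompactSupport_integral_sub_le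
    (show 0 < ε / 8 by positivity)
  have hψu : UniformContinuous ψ := hψc.uniformContinuous_of_continuous hψcont
  obtain ⟨δ, hδ, hψδ⟩ := Metric.uniformContinuous_iff.1 hψu (ε / 8) (by positivity)
  obtain ⟨N, hN⟩ := eventually_atTop.1 (hdiam δ hδ)
  refine ⟨N, fun n hn => ?_⟩
  have hnonneg : 0 ≤ ∫ x, |(m[h|MeasurableSpace.comap (g n) inferInstance]) x - (m[h|Γ]) x| ∂m :=
    integral_nonneg fun x => abs_nonneg _
  rw [Real.dist_eq, sub_zero, abs_of_nonneg hnonneg]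
  have hcongr : ∫ x, |(m[h|MeasurableSpace.comap (g n) inferInstance]) x - (m[h|Γ]) x| ∂m =
      ∫ x, |(m[m[h|Γ]|MeasurableSpace.comap (g n) inferInstance]) x - (m[h|Γ]) x| ∂m := by
    refine integral_congr_ae ?_
    filter_upwards [condExp_condExp_of_le (μ := m) (f := h) (h𝒢Γ n) hΓm] with x hx
    rw [hx]
  have : Nonempty Ω := m.nonempty_of_neZero
  -- A representative in each nonempty cell; sampling `ψ ∘ p` there gives a function constant on
  -- cells. The value on empty cells is immaterial.
  have hpt : ∀ t : τ n, ∃ x : Ω, (∃ y, g n y = t) → g n x = t := fun t => by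
    by_cases ht : ∃ y, g n y = t
    · exact ⟨ht.choose, fun _ => ht.choose_spec⟩
    · exact ⟨Classical.arbitrary Ω, fun h => absurd h ht⟩
  choose r hr using hpt
  set s : Ω → ℝ := fun x => ψ (p (r (g n x))) with hs_def
  have hψp : Integrable (fun x => ψ (p x)) m :=
    (integrable_map_measure hψcont.aestronglyMeasurable hp.aemeasurable).1 (hν ▸ hψi)
  have hs : StronglyMeasurable[MeasurableSpace.comap (g n) inferInstance] s := by
    refine Measurable.stronglyMeasurable ?_
    exact (measurable_of_countable fun t => ψ (p (r t))).comp (comap_measurable (g n))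
  have hclose : ∀ x, |ψ (p x) - s x| ≤ ε / 8 := fun x => by
    rw [← Real.dist_eq]
    exact (hψδ (hN n hn.le x _ (hr (g n x) ⟨x, rfl⟩).symm)).le
  have hsi : Integrable s m := by
    have hd : Integrable (fun x => ψ (p x) - s x) m :=
      Integrable.of_bound ((hψp.aestronglyMeasurable).sub
        (hs.mono ((h𝒢Γ n).trans hΓm)).aestronglyMeasurable) (ε / 8) (ae_of_all _ hclose)
    have := hψp.sub hd
    refine this.congr (ae_of_all _ fun x => ?_)
    simp
  have h1 : ∫ x, |(m[h|Γ]) x - ψ (p x)| ∂m ≤ ε / 8 := by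
    rw [hu]
    refine le_trans (le_of_eq ?_) hψ
    rw [hν]
    exact (integral_map (f := fun y => ‖φ y - ψ y‖) hp.aemeasurable
      (hφ.aestronglyMeasurable.sub hψcont.aestronglyMeasurable).norm).symm
  have hd1 : Integrable (fun x => |(m[h|Γ]) x - ψ (p x)|) m := (integrable_condExp.sub hψp).abs
  have h2 : ∫ x, |(m[h|Γ]) x - s x| ∂m ≤ ε / 4 := by
    calc ∫ x, |(m[h|Γ]) x - s x| ∂m ≤ ∫ x, (|(m[h|Γ]) x - ψ (p x)| + ε / 8) ∂m := by
          refine integral_mono (integrable_condExp.sub hsi).abs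
            (hd1.add (integrable_const _)) fun x => ?_
          have := abs_sub_le ((m[h|Γ]) x) (ψ (p x)) (s x)
          have := hclose x
          simp only
          linarith
      _ = (∫ x, |(m[h|Γ]) x - ψ (p x)| ∂m) + ε / 8 := by
          rw [integral_add hd1 (integrable_const _)]
          simp
      _ ≤ ε / 4 := by linarith
  have h3 := integral_abs_condExp_sub_le ((h𝒢Γ n).trans hΓm) (integrable_condExp (f := h) (m := Γ)) hs hsi
  rw [hcongr]
  linarith

/-- Conditional entropies given finer and finer partitions of a metric space converge to the
conditional entropy given its Borel `σ`-algebra. -/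
theorem tendsto_finEntropy_comap [Fintype ι] {p : Ω → E} (hp : Measurable p) {g : ∀ n, Ω → τ n}
    (hg : ∀ n, Measurable[MeasurableSpace.comap p inferInstance] (g n))
    (hdiam : ∀ ε > 0, ∀ᶠ n in atTop, ∀ x y, g n x = g n y → dist (p x) (p y) < ε)
    {f : Ω → ι} (hf : ∀ i, MeasurableSet (f ⁻¹' {i})) :
    Tendsto (fun n => finEntropy (MeasurableSpace.comap (g n) inferInstance) m f) atTop
      (𝓝 (finEntropy (MeasurableSpace.comap p inferInstance) m f)) :=
  tendsto_finsetSum _ fun i _ => tendsto_integral_negMulLog_condProb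
    (fun n => (hg n).comap_le.trans hp.comap_le) hp.comap_le (hf i)
    (tendsto_integral_abs_condExp_sub hp hg hdiam _)

end Convergence

/-! ### Sequences with almost linear increments. -/

section LinearGrowth

/-- Steps of length `k` lead from `n` back to the window `[N, N + k)`, where `M` bounds the
sequence; there are at most `n / k` of them. -/
lemma abs_le_add_of_abs_sub_le {b : ℕ → ℝ} {C : ℝ} {k N : ℕ} (hk : 0 < k)
    (h : ∀ n ≥ N, |b (n + k) - b n| ≤ C) :
    ∃ M : ℝ, ∀ n ≥ N, |b n| ≤ M + (n / k : ℕ) * C := by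
  obtain ⟨M, hM⟩ : ∃ M : ℝ, ∀ n ∈ Finset.Ico N (N + k), |b n| ≤ M := by
    obtain ⟨M, hM⟩ := ((Finset.Ico N (N + k)).image fun n => |b n|).bddAbove
    exact ⟨M, fun n hn => hM (Finset.mem_coe.2 (Finset.mem_image_of_mem _ hn))⟩
  have hC : 0 ≤ C := (abs_nonneg _).trans (h N le_rfl)
  refine ⟨M, fun n => ?_⟩
  induction n using Nat.strong_induction_on with
  | _ n ih =>
    intro hn
    rcases lt_or_ge n (N + k) with hlt | hge
    · have h1 := hM n (Finset.mem_Ico.2 ⟨hn, hlt⟩)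
      have h2 : 0 ≤ ((n / k : ℕ) : ℝ) * C := by positivity
      linarith
    · obtain ⟨l, rfl⟩ : ∃ l, n = l + k := ⟨n - k, by omega⟩
      have h1 := ih l (by omega) (by omega)
      have h2 := h l (by omega)
      have h3 : (l + k) / k = l / k + 1 := Nat.add_div_right l hk
      have h4 := abs_sub_abs_le_abs_sub (b (l + k)) (b l)
      rw [h3]
      push_cast
      linarith

/-- A sequence whose increments over `k` steps are eventually within a bounded distance of `k * h`,
with a bound independent of `k`, grows linearly with slope `h`. -/
lemma tendsto_div_of_eventually_abs_sub_le {b : ℕ → ℝ} {h C : ℝ}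
    (hb : ∀ k : ℕ, 0 < k → ∀ᶠ n in atTop, |b (n + k) - b n - k * h| ≤ C) :
    Tendsto (fun n : ℕ => b n / n) atTop (𝓝 h) := by
  rw [Metric.tendsto_atTop']
  intro ε hε
  -- Long steps make the error per unit length, `C / (k + 1)`, less than `ε / 2`. The initial
  -- constant `M` costs another `ε / 2` once `n > 2M/ε`.
  obtain ⟨k, hk⟩ := exists_nat_gt (2 * C / ε)
  have hk1 : 2 * C / ε < (k + 1 : ℕ) := hk.trans (by push_cast; linarith)
  have hk0 : (0 : ℝ) < (k + 1 : ℕ) := by positivity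
  obtain ⟨N, hN⟩ := eventually_atTop.1 (hb (k + 1) k.succ_pos)
  have hC : 0 ≤ C := (abs_nonneg _).trans (hN N le_rfl)
  obtain ⟨M, hM⟩ := abs_le_add_of_abs_sub_le (b := fun n => b n - n * h) k.succ_pos fun n hn => by
    have := hN n hn
    rw [show b (n + (k + 1)) - (n + (k + 1) : ℕ) * h - (b n - n * h) =
      b (n + (k + 1)) - b n - (k + 1 : ℕ) * h by push_cast; ring]
    exact this
  obtain ⟨N', hN'⟩ := exists_nat_gt (2 * M / ε)
  refine ⟨max N N', fun n hn => ?_⟩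
  have hn1 : N ≤ n := (le_max_left _ _).trans hn.le
  have hn2 : N' < n := lt_of_le_of_lt (le_max_right _ _) hn
  have hn0 : (0 : ℝ) < n := by exact_mod_cast (Nat.zero_le _).trans_lt hn2
  have h1 := hM n hn1
  have h2 : ((n / (k + 1) : ℕ) : ℝ) ≤ n / (k + 1 : ℕ) := Nat.cast_div_le
  have h3 : ((n / (k + 1) : ℕ) : ℝ) * C ≤ n / (k + 1 : ℕ) * C := by gcongr
  have h4 : (n : ℝ) / (k + 1 : ℕ) * C ≤ n * (ε / 2) := by
    rw [div_mul_eq_mul_div, mul_div_assoc]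
    refine mul_le_mul_of_nonneg_left ?_ hn0.le
    rw [div_le_iff₀ hk0]
    rw [div_lt_iff₀ hε] at hk1
    linarith
  have h5 : M < n * (ε / 2) := by
    rw [div_lt_iff₀ hε] at hN'
    have : (N' : ℝ) * ε ≤ n * ε := by gcongr
    linarith
  rw [Real.dist_eq, show b n / n - h = (b n - n * h) / n by field_simp, abs_div,
    abs_of_pos hn0, div_lt_iff₀ hn0]
  exact h1.trans_lt (by simp only [Nat.succ_eq_add_one]; linarith)

end LinearGrowth

/-! ### Entropy of itineraries and the limit formula in abstract form. -/

section Dynamics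

variable {Ω ι κ τ E : Type*} {𝒜 Γ m0 : MeasurableSpace Ω} {m : Measure Ω}

/-- The itinerary `(f x, f (T x), …, f (T ^ (k - 1) x))`. -/
def itinerary (T : Ω → Ω) (f : Ω → ι) (k : ℕ) (x : Ω) : Fin k → ι := fun i => f (T^[i] x)

lemma itinerary_succ (T : Ω → Ω) (f : Ω → ι) (k : ℕ) (x : Ω) :
    itinerary T f (k + 1) x = Fin.cons (f x) (itinerary T f k (T x)) := by
  funext i
  refine Fin.cases ?_ (fun j => ?_) i
  · simp [itinerary]
  · simp [itinerary]

lemma measurable_itinerary [MeasurableSpace ι] {T : Ω → Ω} (hT : Measurable T) {f : Ω → ι}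
    (hf : Measurable f) (k : ℕ) : Measurable (itinerary T f k) :=
  measurable_pi_lambda _ fun i => hf.comp (hT.iterate i)

lemma finEntropy_itinerary_succ [Fintype ι] (T : Ω → Ω) (f : Ω → ι) (k : ℕ) :
    finEntropy 𝒜 m (itinerary T f (k + 1)) =
      finEntropy 𝒜 m fun x => (f x, itinerary T f k (T x)) := by
  rw [funext (itinerary_succ T f k)]
  exact finEntropy_comp_equiv (Fin.consEquiv fun _ => ι) fun x => (f x, itinerary T f k (T x))

variable [IsProbabilityMeasure m]

/-- `H(e, a) ≤ H(e, a, b) = H(e, b) + H(a | e, b)`, and the last term is at most `log C`. -/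
lemma finEntropy_prod_le_add_log [Fintype ι] [MeasurableSpace ι] [MeasurableSingletonClass ι]
    [Fintype κ] [MeasurableSpace κ] [MeasurableSingletonClass κ]
    [Fintype τ] [MeasurableSpace τ] [MeasurableSingletonClass τ]
    {e : Ω → ι} (he : Measurable e) {a : Ω → κ} (ha : Measurable a) {b : Ω → τ} (hb : Measurable b)
    {C : ℕ} (hC0 : 0 < C) (hC : ∀ w β, {i | ∃ x, a x = i ∧ e x = w ∧ b x = β}.ncard ≤ C) :
    finEntropy ⊥ m (fun x => (e x, a x)) ≤ finEntropy ⊥ m (fun x => (e x, b x)) + Real.log C := by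
  have h1 := finEntropy_prod (m := m) bot_le (he.prodMk hb) ha
  have h2 := finEntropy_prod (m := m) bot_le (he.prodMk ha) hb
  have h3 : finEntropy ⊥ m (fun x => ((e x, a x), b x)) =
      finEntropy ⊥ m (fun x => ((e x, b x), a x)) :=
    finEntropy_comp_equiv ((Equiv.prodAssoc ι τ κ).trans (((Equiv.refl ι).prodCongr
      (Equiv.prodComm τ κ)).trans (Equiv.prodAssoc ι κ τ).symm)) fun x => ((e x, b x), a x)
  rw [bot_sup_eq] at h1 h2
  have h4 := finEntropy_nonneg (m := m) (he.prodMk ha).comap_le (f := b)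
    fun i => hb (measurableSet_singleton i)
  have h5 : finEntropy (MeasurableSpace.comap (fun x => (e x, b x)) inferInstance) m a ≤
      Real.log C := by
    refine finEntropy_le_log (he.prodMk hb).comap_le ha (comap_measurable _) hC0 fun j => ?_
    have := hC j.1 j.2
    simpa only [Prod.ext_iff] using this
  linarith

variable [Fintype ι] [MeasurableSpace ι] [MeasurableSingletonClass ι]

/-- The hypotheses say that, once the symbols read off are known, `Γ` and its pullback carry the
same information. With invariance this makes the entropy difference additive in `k`. -/
lemma finEntropy_itinerary_sub (hΓ : Γ ≤ m0) {T : Ω → Ω}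
    (hT : MeasurePreserving T m m) {f : Ω → ι} (hf : Measurable f)
    (hΓT : ∀ k, Γ ⊔ MeasurableSpace.comap (itinerary T f k) inferInstance =
      Γ.comap T^[k] ⊔ MeasurableSpace.comap (itinerary T f k) inferInstance)
    (hΓf : Γ ⊔ MeasurableSpace.comap f inferInstance =
      Γ.comap T ⊔ MeasurableSpace.comap f inferInstance) (k : ℕ) :
    finEntropy (Γ.comap T^[k]) m (itinerary T f k) - finEntropy Γ m (itinerary T f k) =
      k * (finEntropy (Γ.comap T) m f - finEntropy Γ m f) := by
  induction k with
  | zero => simp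
  | succ k ih =>
    have hTm := hT.measurable
    have hle : Γ.comap T ≤ m0 := (MeasurableSpace.comap_mono hΓ).trans hTm.comap_le
    have hle' : Γ.comap T^[k + 1] ≤ m0 :=
      (MeasurableSpace.comap_mono hΓ).trans (hTm.iterate _).comap_le
    have hfk := measurable_itinerary hTm hf k
    have hg : Measurable fun x => itinerary T f k (T x) := hfk.comp hTm
    have hcomp : Γ.comap T^[k + 1] = (Γ.comap T^[k]).comap T := by
      rw [MeasurableSpace.comap_comp, Function.iterate_succ]
    have hσ : MeasurableSpace.comap (fun x => itinerary T f k (T x)) inferInstance =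
        (MeasurableSpace.comap (itinerary T f k) inferInstance).comap T := by
      rw [MeasurableSpace.comap_comp]
      rfl
    have hfib : ∀ w, MeasurableSet (itinerary T f k ⁻¹' {w}) := fun w => hfk (measurableSet_singleton w)
    have ha := finEntropy_prod' (m := m) hle' hf hg
    have hb := finEntropy_prod (m := m) hΓ hf hg
    -- Expanding the joint entropy given `T⁻¹Γ` in both orders relates the conditional terms left
    -- over in `ha` and `hb`, so that they cancel.
    have hc := finEntropy_prod (m := m) hle hf hg
    have hc' := finEntropy_prod' (m := m) hle hf hg
    rw [hσ, hcomp, ← MeasurableSpace.comap_sup, ← hΓT k, finEntropy_comp_measurePreserving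
      ((MeasurableSpace.comap_mono hΓ).trans (hTm.iterate _).comap_le) hT hfib] at ha
    rw [hσ, ← MeasurableSpace.comap_sup, finEntropy_comp_measurePreserving hΓ hT hfib] at hc'
    rw [hΓf] at hb
    rw [finEntropy_itinerary_succ, finEntropy_itinerary_succ, hcomp, ha, hb]
    push_cast
    linarith

variable [MetricSpace E] [ProperSpace E] [MeasurableSpace E] [BorelSpace E]
  {τ : ℕ → Type*} [∀ n, Fintype (τ n)] [∀ n, MeasurableSpace (τ n)]
  [∀ n, MeasurableSingletonClass (τ n)]

/-- The two counting hypotheses make `H(P_k, q_{n+k})` and `H(P_k, q_n ∘ T^k)` differ by at most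
`log C`. The chain rule turns this into a statement on `b_{n+k} - b_n` and two conditional entropies
with known limits. -/
theorem tendsto_finEntropy_div {T : Ω → Ω} (hT : MeasurePreserving T m m) {f : Ω → ι}
    (hf : Measurable f) {p : Ω → E} (hp : Measurable p)
    (hΓ : Γ = MeasurableSpace.comap p inferInstance)
    (hΓT : ∀ k, Γ ⊔ MeasurableSpace.comap (itinerary T f k) inferInstance =
      Γ.comap T^[k] ⊔ MeasurableSpace.comap (itinerary T f k) inferInstance)
    (hΓf : Γ ⊔ MeasurableSpace.comap f inferInstance =
      Γ.comap T ⊔ MeasurableSpace.comap f inferInstance)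
    {q : ∀ n, Ω → τ n} (hq : ∀ n, Measurable[Γ] (q n))
    (hdiam : ∀ ε > 0, ∀ᶠ n in atTop, ∀ x y, q n x = q n y → dist (p x) (p y) < ε)
    {C : ℕ} (hC0 : 0 < C)
    (hC : ∀ k n w β, {i | ∃ x, q (n + k) x = i ∧ itinerary T f k x = w ∧
      q n (T^[k] x) = β}.ncard ≤ C)
    (hC' : ∀ k n w β, {i | ∃ x, q n (T^[k] x) = i ∧ itinerary T f k x = w ∧
      q (n + k) x = β}.ncard ≤ C) :
    Tendsto (fun n : ℕ => finEntropy ⊥ m (q n) / n) atTop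
      (𝓝 (finEntropy (Γ.comap T) m f - finEntropy Γ m f)) := by
  have hTm := hT.measurable
  have hΓm : Γ ≤ m0 := hΓ ▸ hp.comap_le
  have hq' : ∀ n, Measurable (q n) := fun n => (hq n).mono hΓm le_rfl
  -- `log C` comes from the counting, `1` from waiting until the conditional entropies are that
  -- close to their limit. Neither depends on `k`; only the threshold for `n` does.
  refine tendsto_div_of_eventually_abs_sub_le (C := Real.log C + 1) fun k _ => ?_
  have hTk := hT.iterate k
  have hfk := measurable_itinerary hTm hf k
  have hfib : ∀ w, MeasurableSet (itinerary T f k ⁻¹' {w}) := fun w => hfk (measurableSet_singleton w)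
  have hqT : ∀ n, Measurable fun x => q n (T^[k] x) := fun n => (hq' n).comp hTk.measurable
  have hlim1 : Tendsto (fun n => finEntropy (MeasurableSpace.comap (q (n + k)) inferInstance) m
      (itinerary T f k)) atTop (𝓝 (finEntropy Γ m (itinerary T f k))) := by
    have := tendsto_finEntropy_comap (m := m) hp (fun n => hΓ ▸ hq n) hdiam hfib
    rw [← hΓ] at this
    exact this.comp (tendsto_add_atTop_nat k)
  have hlim2 : Tendsto (fun n => finEntropy (MeasurableSpace.comap (fun x => q n (T^[k] x))
      inferInstance) m (itinerary T f k)) atTop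
        (𝓝 (finEntropy (Γ.comap T^[k]) m (itinerary T f k))) := by
    have hΓk : Γ.comap T^[k] = MeasurableSpace.comap (fun x => p (T^[k] x)) inferInstance := by
      rw [hΓ, MeasurableSpace.comap_comp]
      rfl
    rw [hΓk]
    refine tendsto_finEntropy_comap (hp.comp hTk.measurable) (fun n => ?_) ?_ hfib
    · have h := (hq n).comp (comap_measurable (m := Γ) T^[k])
      rw [hΓk] at h
      exact h
    · intro ε hε
      filter_upwards [hdiam ε hε] with n hn x y hxy using hn _ _ hxy
  have hlim := hlim2.sub hlim1
  rw [finEntropy_itinerary_sub hΓm hT hf hΓT hΓf k] at hlim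
  filter_upwards [(Metric.tendsto_nhds.1 hlim) 1 one_pos] with n hn
  rw [Real.dist_eq] at hn
  have e1 := finEntropy_prod' (m := m) bot_le hfk (hq' (n + k))
  have e2 := finEntropy_prod' (m := m) bot_le hfk (hqT n)
  have e3 : finEntropy ⊥ m (fun x => q n (T^[k] x)) = finEntropy ⊥ m (q n) := by
    rw [← finEntropy_comp_measurePreserving bot_le hTk fun i => hq' n (measurableSet_singleton i),
      MeasurableSpace.comap_bot]
  have e4 := finEntropy_prod_le_add_log (m := m) hfk (hq' (n + k)) (hqT n) hC0 (hC k n)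
  have e5 := finEntropy_prod_le_add_log (m := m) hfk (hqT n) (hq' (n + k)) hC0 (hC' k n)
  rw [bot_sup_eq] at e1 e2
  rw [abs_lt] at hn
  rw [abs_le]
  constructor <;> linarith

end Dynamics

/-! ### Equivariance and range of the coding map. -/

section Coding

variable {ℓ : ℕ}

lemma leftShift_iterate_apply (k n : ℕ) (x : ShiftSpace ℓ) : leftShift^[k] x n = x (n + k) := by
  induction k generalizing n with
  | zero => rfl
  | succ k ih =>
    rw [Function.iterate_succ_apply', leftShift, ih]
    congr 1
    omega

variable {E : Type*} [MetricSpace E] [CompleteSpace E] [Nonempty E] {S : Fin ℓ → E → E} {r : ℝ≥0}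

lemma codingMap_eq_apply_leftShift (hℓ : 1 ≤ ℓ) (hr : r < 1) (hS : ∀ i, LipschitzWith r (S i))
    (x : ShiftSpace ℓ) : codingMap S x = S (x 0) (codingMap S (leftShift x)) := by
  have hK := isAttractor_attractor hℓ hr hS
  have hmem : codingMap S (leftShift x) ∈
      ⋂ n : ℕ, wordMap S (leftShift x) (n + 1) '' attractor S := by
    rw [← singleton_codingMap hℓ hr hS]
    rfl
  have h : S (x 0) (codingMap S (leftShift x)) ∈ ⋂ n : ℕ, wordMap S x (n + 1) '' attractor S := by
    refine mem_iInter.2 fun n => ?_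
    obtain ⟨z, hz, hzx⟩ := mem_iInter.1 hmem n
    refine ⟨S (x (n + 1)) z, hK.image_subset _ ⟨z, hz, rfl⟩, ?_⟩
    rw [← hzx, wordMap_succ' S x n, Function.comp_apply]
    rfl
  rw [← singleton_codingMap hℓ hr hS] at h
  exact (mem_singleton_iff.1 h).symm

/-- Equivariance makes the range a compact solution of the attractor equation, and that solution is
unique. -/
lemma range_codingMap (hℓ : 1 ≤ ℓ) (hr : r < 1) (hS : ∀ i, LipschitzWith r (S i)) :
    range (codingMap S) = attractor S := by
  refine IsAttractor.unique hr hS ⟨⟨_, fun _ => ⟨0, hℓ⟩, rfl⟩,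
    isCompact_range (continuous_codingMap hℓ hr hS), ?_⟩ (isAttractor_attractor hℓ hr hS)
  ext y
  simp only [mem_range, mem_iUnion, mem_image]
  constructor
  · rintro ⟨x, rfl⟩
    exact ⟨x 0, _, ⟨leftShift x, rfl⟩, (codingMap_eq_apply_leftShift hℓ hr hS x).symm⟩
  · rintro ⟨i, _, ⟨x, rfl⟩, rfl⟩
    let z : ShiftSpace ℓ := fun n => Nat.casesOn n i x
    exact ⟨z, codingMap_eq_apply_leftShift hℓ hr hS z⟩

end Coding

/-! ### Counting lattice cubes. -/

section Cubes

variable {d : ℕ}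

/-- The index of the cube of the unit lattice that contains a point. -/
noncomputable def cubeIndex (y : EuclideanSpace ℝ (Fin d)) : Fin d → ℤ := fun j => ⌊y j⌋

lemma mem_unitCube_iff {y : EuclideanSpace ℝ (Fin d)} {α : Fin d → ℤ} :
    y ∈ unitCube α ↔ cubeIndex y = α := by
  simp only [unitCube, mem_ofPred_eq, cubeIndex, funext_iff, Int.floor_eq_iff]

lemma unitCube_injective : Function.Injective (unitCube (d := d)) := by
  intro α β h
  have hα : (WithLp.toLp 2 fun j => (α j : ℝ) : EuclideanSpace ℝ (Fin d)) ∈ unitCube α := by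
    intro j
    simp
  have h1 := mem_unitCube_iff.1 hα
  rw [h] at hα
  rw [← h1, mem_unitCube_iff.1 hα]

lemma measurable_cubeIndex : Measurable (cubeIndex (d := d)) :=
  measurable_pi_lambda _ fun j => Int.measurable_floor.comp (by fun_prop)

lemma norm_le_sqrt_of_abs_le_one {u : EuclideanSpace ℝ (Fin d)} (h : ∀ j, |u j| ≤ 1) :
    ‖u‖ ≤ √d := by
  rw [EuclideanSpace.norm_eq]
  refine Real.sqrt_le_sqrt ?_
  calc ∑ j, ‖u j‖ ^ 2 ≤ ∑ _j : Fin d, (1 : ℝ) :=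
        Finset.sum_le_sum fun j _ => pow_le_one₀ (norm_nonneg _) (h j)
    _ = d := by simp

lemma dist_le_sqrt_of_cubeIndex_eq {y z : EuclideanSpace ℝ (Fin d)}
    (h : cubeIndex y = cubeIndex z) : dist y z ≤ √d := by
  rw [dist_eq_norm]
  refine norm_le_sqrt_of_abs_le_one fun j => ?_
  exact (Int.abs_sub_lt_one_of_floor_eq_floor (congrFun h j)).le

lemma abs_sub_apply_le_dist (y z : EuclideanSpace ℝ (Fin d)) (j : Fin d) :
    |y j - z j| ≤ dist y z := by
  rw [dist_eq_norm]
  exact PiLp.norm_apply_le (y - z) j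

lemma ncard_le_pow_of_forall_mem_Icc {s : Set (Fin d → ℤ)} {a b : Fin d → ℤ} {C : ℕ}
    (hs : ∀ α ∈ s, a ≤ α ∧ α ≤ b) (hC : ∀ j, b j + 1 - a j ≤ C) : s.ncard ≤ C ^ d := by
  have h1 : s.ncard ≤ (Finset.Icc a b).card := by
    rw [← Set.ncard_coe_finset]
    exact Set.ncard_le_ncard (fun α hα => by simpa using hs α hα) (Finset.finite_toSet _)
  refine h1.trans ?_
  rw [Pi.card_Icc]
  refine (Finset.prod_le_pow_card _ _ C fun j _ => ?_).trans (by simp)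
  rw [Int.card_Icc]
  exact Int.toNat_le.2 (hC j)

lemma mem_Icc_cubeIndex_add (y v : EuclideanSpace ℝ (Fin d)) :
    cubeIndex (y + v) ∈ Icc (fun j => cubeIndex y j + ⌊v j⌋) fun j => cubeIndex y j + ⌊v j⌋ + 1 :=
  ⟨fun j => Int.le_floor_add _ _, fun j => by
    have := Int.le_floor_add_floor (y j) (v j)
    simp only [cubeIndex, PiLp.add_apply]
    linarith⟩

/-- A translation changes the index of a cube in at most `2 ^ d` ways. -/
lemma ncard_cubeIndex_add_le (v : EuclideanSpace ℝ (Fin d)) (β : Fin d → ℤ) :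
    {α | ∃ y, cubeIndex (y + v) = α ∧ cubeIndex y = β}.ncard ≤ 2 ^ d := by
  refine ncard_le_pow_of_forall_mem_Icc (a := fun j => β j + ⌊v j⌋) (b := fun j => β j + ⌊v j⌋ + 1)
    ?_ fun j => by omega
  rintro _ ⟨y, rfl, rfl⟩
  exact mem_Icc_cubeIndex_add y v

/-- Needed beside the cardinality bound: `ncard` of an infinite set is `0`, so monotonicity of
`ncard` requires finiteness. -/
lemma finite_cubeIndex_add (v : EuclideanSpace ℝ (Fin d)) (β : Fin d → ℤ) :
    {α | ∃ y, cubeIndex (y + v) = α ∧ cubeIndex y = β}.Finite := by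
  refine (Set.finite_Icc (fun j => β j + ⌊v j⌋) fun j => β j + ⌊v j⌋ + 1).subset ?_
  rintro _ ⟨y, rfl, rfl⟩
  exact mem_Icc_cubeIndex_add y v

lemma cubeIndex_mem_Icc_of_dist_le {y z : EuclideanSpace ℝ (Fin d)} {r : ℕ} (h : dist y z ≤ r) (j : Fin d) :
    cubeIndex z j - r ≤ cubeIndex y j ∧ cubeIndex y j ≤ cubeIndex z j + r := by
  have h1 := abs_le.1 ((abs_sub_apply_le_dist y z j).trans h)
  constructor
  · rw [cubeIndex, cubeIndex, ← Int.floor_sub_natCast]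
    exact Int.floor_le_floor (by linarith)
  · rw [cubeIndex, cubeIndex, ← Int.floor_add_natCast]
    exact Int.floor_le_floor (by linarith)

/-- A set of bounded diameter meets boundedly many cubes. -/
lemma ncard_cubeIndex_image_le {D : Set (EuclideanSpace ℝ (Fin d))} {r : ℕ}
    (hD : ∀ y ∈ D, ∀ z ∈ D, dist y z ≤ r) : (cubeIndex '' D).ncard ≤ (2 * r + 1) ^ d := by
  rcases D.eq_empty_or_nonempty with rfl | ⟨z, hz⟩
  · simp
  refine ncard_le_pow_of_forall_mem_Icc (a := fun j => cubeIndex z j - r)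
    (b := fun j => cubeIndex z j + r) ?_ fun j => by push_cast; omega
  rintro _ ⟨y, hy, rfl⟩
  exact ⟨fun j => (cubeIndex_mem_Icc_of_dist_le (hD y hy z hz) j).1,
    fun j => (cubeIndex_mem_Icc_of_dist_le (hD y hy z hz) j).2⟩

lemma finite_cubeIndex_image {D : Set (EuclideanSpace ℝ (Fin d))} (hD : Bornology.IsBounded D) :
    (cubeIndex '' D).Finite := by
  rcases D.eq_empty_or_nonempty with rfl | ⟨z, hz⟩
  · simp
  obtain ⟨C, hC⟩ := Metric.isBounded_iff.1 hD
  obtain ⟨r, hr⟩ := exists_nat_ge C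
  refine (Finset.finite_toSet (Finset.Icc (fun j => cubeIndex z j - (r : ℤ))
    fun j => cubeIndex z j + (r : ℤ))).subset ?_
  rintro _ ⟨y, hy, rfl⟩
  have h := cubeIndex_mem_Icc_of_dist_le ((hC hy hz).trans hr)
  rw [Finset.coe_Icc]
  exact ⟨fun j => (h j).1, fun j => (h j).2⟩

end Cubes

/-! ### Powers of the linear part and their inverses. -/

section LinearPart

variable {d : ℕ} {A : Matrix (Fin d) (Fin d) ℝ}

/-- The linear map `A ^ n`. -/
noncomputable abbrev linPow (A : Matrix (Fin d) (Fin d) ℝ) (n : ℕ) :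
    EuclideanSpace ℝ (Fin d) →L[ℝ] EuclideanSpace ℝ (Fin d) :=
  Matrix.toEuclideanCLM (𝕜 := ℝ) (A ^ n)

/-- The linear map `A ^ (-n)`. -/
noncomputable abbrev linPowInv (A : Matrix (Fin d) (Fin d) ℝ) (n : ℕ) :
    EuclideanSpace ℝ (Fin d) →L[ℝ] EuclideanSpace ℝ (Fin d) :=
  Matrix.toEuclideanCLM (𝕜 := ℝ) (A ^ n)⁻¹

lemma toEuclideanCLM_mul_apply (B C : Matrix (Fin d) (Fin d) ℝ) (y : EuclideanSpace ℝ (Fin d)) :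
    Matrix.toEuclideanCLM (𝕜 := ℝ) (B * C) y =
      Matrix.toEuclideanCLM (𝕜 := ℝ) B (Matrix.toEuclideanCLM (𝕜 := ℝ) C y) := by
  rw [map_mul]
  rfl

lemma toEuclideanCLM_one_apply (y : EuclideanSpace ℝ (Fin d)) :
    Matrix.toEuclideanCLM (𝕜 := ℝ) (1 : Matrix (Fin d) (Fin d) ℝ) y = y := by
  rw [map_one]
  rfl

lemma isUnit_det_pow (hdet : A.det ≠ 0) (n : ℕ) : IsUnit (A ^ n).det := by
  rw [Matrix.det_pow]
  exact (isUnit_iff_ne_zero.2 hdet).pow n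

lemma linPow_linPowInv (hdet : A.det ≠ 0) (n : ℕ) (y : EuclideanSpace ℝ (Fin d)) :
    linPow A n (linPowInv A n y) = y := by
  rw [← toEuclideanCLM_mul_apply, Matrix.mul_nonsing_inv _ (isUnit_det_pow hdet n),
    toEuclideanCLM_one_apply]

lemma linPowInv_linPow (hdet : A.det ≠ 0) (n : ℕ) (y : EuclideanSpace ℝ (Fin d)) :
    linPowInv A n (linPow A n y) = y := by
  rw [← toEuclideanCLM_mul_apply, Matrix.nonsing_inv_mul _ (isUnit_det_pow hdet n),
    toEuclideanCLM_one_apply]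

lemma linPow_add_apply (n k : ℕ) (y : EuclideanSpace ℝ (Fin d)) :
    linPow A (n + k) y = linPow A n (linPow A k y) := by
  rw [linPow, pow_add, toEuclideanCLM_mul_apply]

lemma linPowInv_add_linPow (hdet : A.det ≠ 0) (n k : ℕ) (y : EuclideanSpace ℝ (Fin d)) :
    linPowInv A (n + k) (linPow A k y) = linPowInv A n y := by
  conv_lhs => rw [← linPow_linPowInv hdet n y, ← linPow_add_apply, add_comm k n]
  exact linPowInv_linPow hdet (n + k) _

lemma norm_linPow_le (n : ℕ) (y : EuclideanSpace ℝ (Fin d)) :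
    ‖linPow A n y‖ ≤ ‖Matrix.toEuclideanCLM (𝕜 := ℝ) A‖ ^ n * ‖y‖ := by
  induction n generalizing y with
  | zero => rw [linPow, pow_zero, toEuclideanCLM_one_apply, pow_zero, one_mul]
  | succ n ih =>
    rw [linPow_add_apply, pow_succ, mul_assoc]
    refine (ih _).trans ?_
    gcongr
    rw [linPow, pow_one]
    exact ContinuousLinearMap.le_opNorm _ _

lemma dist_linPow_le (hA : ‖Matrix.toEuclideanCLM (𝕜 := ℝ) A‖ < 1) (n : ℕ)
    (y z : EuclideanSpace ℝ (Fin d)) : dist (linPow A n y) (linPow A n z) ≤ dist y z := by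
  rw [dist_eq_norm, dist_eq_norm, ← map_sub]
  exact (norm_linPow_le n _).trans (mul_le_of_le_one_left (norm_nonneg _)
    (pow_le_one₀ (norm_nonneg _) hA.le))

end LinearPart

/-- If `p` and `p'` are measurable functions of each other once `f` is known, then `(p, f)` and
`(p', f)` generate the same σ-algebra. -/
lemma comap_sup_comap_eq {Ω κ E : Type*} [MeasurableSpace κ] [MeasurableSpace E] {p p' : Ω → E}
    {f : Ω → κ} {F G : E → κ → E} (hF : Measurable (Function.uncurry F))
    (hG : Measurable (Function.uncurry G)) (hpF : ∀ x, p x = F (p' x) (f x))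
    (hpG : ∀ x, p' x = G (p x) (f x)) :
    MeasurableSpace.comap p inferInstance ⊔ MeasurableSpace.comap f inferInstance =
      MeasurableSpace.comap p' inferInstance ⊔ MeasurableSpace.comap f inferInstance := by
  have key : ∀ {p p' : Ω → E} {F : E → κ → E}, Measurable (Function.uncurry F) →
      (∀ x, p x = F (p' x) (f x)) → MeasurableSpace.comap p inferInstance ≤
        MeasurableSpace.comap p' inferInstance ⊔ MeasurableSpace.comap f inferInstance := by
    intro p p' F hF hp
    rw [← MeasurableSpace.comap_prodMk]
    refine Measurable.comap_le ?_
    rw [show p = Function.uncurry F ∘ fun x => (p' x, f x) from funext hp]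
    exact hF.comp (comap_measurable _)
  exact le_antisymm (sup_le (key hF hpF) le_sup_right) (sup_le (key hG hpG) le_sup_right)

/-! ### The coding map of the affine system and its rescaling. -/

section AffineCoding

variable {d ℓ : ℕ} {A : Matrix (Fin d) (Fin d) ℝ}

lemma measurable_leftShift : Measurable (leftShift (ℓ := ℓ)) :=
  measurable_pi_lambda _ fun n => measurable_pi_apply (n + 1)

/-- The translation part of the composition of the maps coded by a word of length `k`. -/
noncomputable def wordTranslation (A : Matrix (Fin d) (Fin d) ℝ)
    (c : Fin ℓ → EuclideanSpace ℝ (Fin d)) (k : ℕ) (w : Fin k → Fin ℓ) :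
    EuclideanSpace ℝ (Fin d) :=
  ∑ i : Fin k, linPow A i (c (w i))

/-- The word formed by the first `k` symbols. -/
abbrev prefixWord (k : ℕ) (x : ShiftSpace ℓ) : Fin k → Fin ℓ := itinerary leftShift (fun x => x 0) k x

lemma prefixWord_apply (k : ℕ) (x : ShiftSpace ℓ) (i : Fin k) : prefixWord k x i = x i := by
  rw [prefixWord, itinerary, leftShift_iterate_apply, zero_add]

/-- The index of the element of `𝒬_n` that contains the point coded by `x`. -/
noncomputable def cubeCode (A : Matrix (Fin d) (Fin d) ℝ) (c : Fin ℓ → EuclideanSpace ℝ (Fin d))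
    (n : ℕ) (x : ShiftSpace ℓ) : Fin d → ℤ :=
  cubeIndex (linPowInv A n (codingMap (affineIFS A c) x))

lemma mem_cubeImage_iff (hdet : A.det ≠ 0) {n : ℕ} {α : Fin d → ℤ} {y : EuclideanSpace ℝ (Fin d)} :
    y ∈ cubeImage A n α ↔ cubeIndex (linPowInv A n y) = α := by
  rw [← mem_unitCube_iff]
  constructor
  · rintro ⟨z, hz, rfl⟩
    rwa [linPowInv_linPow hdet]
  · exact fun h => ⟨_, h, linPow_linPowInv hdet n y⟩

lemma pulledCubes_eq (hdet : A.det ≠ 0) (c : Fin ℓ → EuclideanSpace ℝ (Fin d)) (n : ℕ)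
    (α : Fin d → ℤ) : pulledCubes A c n α = cubeCode A c n ⁻¹' {α} := by
  ext x
  rw [pulledCubes, mem_preimage, mem_cubeImage_iff hdet]
  rfl

lemma measurable_cubeCode_comap (c : Fin ℓ → EuclideanSpace ℝ (Fin d)) (n : ℕ) :
    Measurable[MeasurableSpace.comap (codingMap (affineIFS A c)) inferInstance] (cubeCode A c n) :=
  (measurable_cubeIndex.comp (linPowInv A n).continuous.measurable).comp (comap_measurable _)

/-- An element of `𝒬_n` has diameter at most `‖A‖^n √d`. -/
lemma eventually_dist_codingMap_lt (hdet : A.det ≠ 0)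
    (hA : ‖Matrix.toEuclideanCLM (𝕜 := ℝ) A‖ < 1) (c : Fin ℓ → EuclideanSpace ℝ (Fin d)) {ε : ℝ} (hε : 0 < ε) :
    ∀ᶠ n in atTop, ∀ x y : ShiftSpace ℓ, cubeCode A c n x = cubeCode A c n y →
      dist (codingMap (affineIFS A c) x) (codingMap (affineIFS A c) y) < ε := by
  have h0 : Tendsto (fun n : ℕ => ‖Matrix.toEuclideanCLM (𝕜 := ℝ) A‖ ^ n * √d) atTop (𝓝 0) := by
    simpa using (tendsto_pow_atTop_nhds_zero_of_lt_one (norm_nonneg _) hA).mul_const (√d)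
  filter_upwards [h0.eventually (gt_mem_nhds hε)] with n hn x y hxy
  refine lt_of_le_of_lt ?_ hn
  have h1 := dist_le_sqrt_of_cubeIndex_eq hxy
  rw [dist_eq_norm, ← linPow_linPowInv hdet n (codingMap (affineIFS A c) x - _)]
  refine (norm_linPow_le n _).trans ?_
  rw [map_sub, ← dist_eq_norm]
  gcongr

lemma codingSigma_eq (c : Fin ℓ → EuclideanSpace ℝ (Fin d)) : codingSigma (affineIFS A c) =
    MeasurableSpace.comap (codingMap (affineIFS A c)) inferInstance := by
  rw [codingSigma, ← BorelSpace.measurable_eq]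

variable (hℓ : 1 ≤ ℓ) (hdet : A.det ≠ 0) (hA : ‖Matrix.toEuclideanCLM (𝕜 := ℝ) A‖ < 1)
  (c : Fin ℓ → EuclideanSpace ℝ (Fin d))

include hℓ hA

lemma continuous_codingMap_affineIFS : Continuous (codingMap (affineIFS A c)) :=
  continuous_codingMap hℓ (by exact_mod_cast hA) (lipschitzWith_affineIFS A c)

lemma range_codingMap_affineIFS : range (codingMap (affineIFS A c)) = attractor (affineIFS A c) :=
  range_codingMap hℓ (by exact_mod_cast hA) (lipschitzWith_affineIFS A c)

/-- Here the common linear part enters: a composition of `k` maps has linear part `A^k` whatever the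
word, which affects only the translation. -/
lemma codingMap_eq_linPow_add (k : ℕ) (x : ShiftSpace ℓ) :
    codingMap (affineIFS A c) x =
      linPow A k (codingMap (affineIFS A c) (leftShift^[k] x)) +
        wordTranslation A c k (prefixWord k x) := by
  induction k with
  | zero => simp [linPow, wordTranslation]
  | succ k ih =>
    have h := codingMap_eq_apply_leftShift (S := affineIFS A c) hℓ (by exact_mod_cast hA)
      (lipschitzWith_affineIFS A c) (leftShift^[k] x)
    conv_lhs => rw [ih, h, affineIFS, map_add, ← toEuclideanCLM_mul_apply, ← pow_succ]
    rw [← Function.iterate_succ_apply' leftShift k x, add_assoc]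
    congr 1
    rw [wordTranslation, wordTranslation, Fin.sum_univ_castSucc, add_comm]
    rfl

lemma finite_range_cubeCode (n : ℕ) : (range (cubeCode A c n)).Finite := by
  have h : IsCompact (range fun x => linPowInv A n (codingMap (affineIFS A c) x)) :=
    isCompact_range ((linPowInv A n).continuous.comp (continuous_codingMap_affineIFS hℓ hA c))
  refine (finite_cubeIndex_image h.isBounded).subset ?_
  rintro _ ⟨x, rfl⟩
  exact ⟨_, ⟨x, rfl⟩, rfl⟩

lemma measurable_cubeCode (n : ℕ) : Measurable (cubeCode A c n) :=
  (measurable_cubeIndex.comp (linPowInv A n).continuous.measurable).comp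
    (continuous_codingMap_affineIFS hℓ hA c).measurable

include hdet

lemma meetingCubes_eq (n : ℕ) : meetingCubes A c n = unitCube '' range (cubeCode A c n) := by
  ext Q
  simp only [meetingCubes, mem_ofPred_eq, ← range_codingMap_affineIFS hℓ hA c]
  constructor
  · rintro ⟨⟨α, rfl⟩, y, hy, x, rfl⟩
    exact ⟨α, ⟨x, (mem_cubeImage_iff hdet).1 hy⟩, rfl⟩
  · rintro ⟨_, ⟨x, rfl⟩, rfl⟩
    exact ⟨⟨_, rfl⟩, _, (mem_cubeImage_iff hdet).2 rfl, x, rfl⟩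

/-- For a fixed prefix of length `k`, passing from level `n` at `σ^k x` to level `n + k` at `x` is a
translation in rescaled coordinates, hence the bound `2^d` in `ncard_cubeCode_add_le`. -/
lemma linPowInv_codingMap (n k : ℕ) (x : ShiftSpace ℓ) :
    linPowInv A (n + k) (codingMap (affineIFS A c) x) =
      linPowInv A n (codingMap (affineIFS A c) (leftShift^[k] x)) +
        linPowInv A (n + k) (wordTranslation A c k (prefixWord k x)) := by
  conv_lhs => rw [codingMap_eq_linPow_add hℓ hA c k x]
  rw [map_add, linPowInv_add_linPow hdet]

lemma ncard_cubeCode_add_le (k n : ℕ) (w : Fin k → Fin ℓ) (β : Fin d → ℤ) :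
    {α | ∃ x, cubeCode A c (n + k) x = α ∧ prefixWord k x = w ∧
      cubeCode A c n (leftShift^[k] x) = β}.ncard ≤ 2 ^ d ∧
    {α | ∃ x, cubeCode A c n (leftShift^[k] x) = α ∧ prefixWord k x = w ∧
      cubeCode A c (n + k) x = β}.ncard ≤ 2 ^ d := by
  constructor
  · refine le_trans (Set.ncard_le_ncard ?_ (finite_cubeIndex_add _ β))
      (ncard_cubeIndex_add_le (linPowInv A (n + k) (wordTranslation A c k w)) β)
    rintro _ ⟨x, rfl, rfl, hx⟩
    exact ⟨_, congrArg cubeIndex (linPowInv_codingMap hℓ hdet hA c n k x).symm, hx⟩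
  · refine le_trans (Set.ncard_le_ncard ?_ (finite_cubeIndex_add _ β))
      (ncard_cubeIndex_add_le (-linPowInv A (n + k) (wordTranslation A c k w)) β)
    rintro _ ⟨x, rfl, rfl, hx⟩
    refine ⟨_, congrArg cubeIndex ?_, hx⟩
    rw [linPowInv_codingMap hℓ hdet hA c n k x, add_neg_cancel_right]

/-- Given the prefix, `π(x)` and `π(σ^k x)` are affine functions of each other; one direction uses
that `A` is invertible. -/
lemma codingSigma_sup_comap_prefixWord (k : ℕ) :
    codingSigma (affineIFS A c) ⊔ MeasurableSpace.comap (prefixWord k) inferInstance =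
      (codingSigma (affineIFS A c)).comap leftShift^[k] ⊔
        MeasurableSpace.comap (prefixWord k) inferInstance := by
  rw [codingSigma, ← BorelSpace.measurable_eq, MeasurableSpace.comap_comp]
  refine comap_sup_comap_eq (F := fun y w => linPow A k y + wordTranslation A c k w)
    (G := fun y w => linPowInv A k (y - wordTranslation A c k w)) ?_ ?_ ?_ ?_
  · exact ((linPow A k).continuous.measurable.comp measurable_fst).add
      ((measurable_of_countable (wordTranslation A c k)).comp measurable_snd)
  · exact (linPowInv A k).continuous.measurable.comp (measurable_fst.sub
      ((measurable_of_countable (wordTranslation A c k)).comp measurable_snd))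
  · exact fun x => codingMap_eq_linPow_add hℓ hA c k x
  · intro x
    rw [codingMap_eq_linPow_add hℓ hA c k x, add_sub_cancel_right, linPowInv_linPow hdet]
    rfl

lemma codingSigma_sup_comap_zero :
    codingSigma (affineIFS A c) ⊔ MeasurableSpace.comap (fun x : ShiftSpace ℓ => x 0) inferInstance =
      (codingSigma (affineIFS A c)).comap leftShift ⊔
        MeasurableSpace.comap (fun x : ShiftSpace ℓ => x 0) inferInstance := by
  have h : MeasurableSpace.comap (fun x : ShiftSpace ℓ => x 0) inferInstance =
      MeasurableSpace.comap (prefixWord 1) inferInstance := by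
    refine le_antisymm ?_ ?_
    · exact Measurable.comap_le
        ((measurable_pi_apply (0 : Fin 1)).comp (comap_measurable (prefixWord 1)))
    · have h1 : prefixWord (ℓ := ℓ) 1 = (fun a _ => a) ∘ fun x => x 0 := by
        funext x i
        rw [Subsingleton.elim i 0]
        rfl
      rw [h1, ← MeasurableSpace.comap_comp]
      exact MeasurableSpace.comap_mono (measurable_of_countable _).comap_le
  rw [h]
  exact codingSigma_sup_comap_prefixWord hℓ hdet hA c 1

end AffineCoding

/-! ### Projection entropy as the growth rate of the entropy of the cubes. -/

section ProjectionEntropy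

variable {d ℓ : ℕ} {A : Matrix (Fin d) (Fin d) ℝ} {c : Fin ℓ → EuclideanSpace ℝ (Fin d)}
  {s : ℕ → Finset (Fin d → ℤ)}

/-- The cube code as a variable with values in a finite set of indices. -/
noncomputable def finCode (hs : ∀ n, (s n : Set (Fin d → ℤ)) = range (cubeCode A c n)) (n : ℕ)
    (x : ShiftSpace ℓ) : s n :=
  ⟨cubeCode A c n x, by
    rw [← Finset.mem_coe, hs n]
    exact mem_range_self x⟩

variable (hs : ∀ n, (s n : Set (Fin d → ℤ)) = range (cubeCode A c n))

lemma finCode_eq_iff {n : ℕ} {x : ShiftSpace ℓ} {α : s n} :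
    finCode hs n x = α ↔ cubeCode A c n x = α := by
  rw [Subtype.ext_iff]
  rfl

lemma finCode_preimage (hdet : A.det ≠ 0) (n : ℕ) (α : s n) :
    finCode hs n ⁻¹' {α} = pulledCubes A c n α := by
  rw [pulledCubes_eq hdet]
  ext x
  exact finCode_eq_iff hs

lemma pulledCubes_eq_empty
    (hs : ∀ n, (s n : Set (Fin d → ℤ)) = range (cubeCode A c n)) (hdet : A.det ≠ 0) {n : ℕ} {α : Fin d → ℤ} (hα : α ∉ s n) :
    pulledCubes A c n α = ∅ := by
  rw [pulledCubes_eq hdet, preimage_singleton_eq_empty, ← hs n]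
  exact hα

section Measure

variable {m : Measure (ShiftSpace ℓ)} [IsProbabilityMeasure m]

lemma measurableSet_pulledCubes (hℓ : 1 ≤ ℓ) (hdet : A.det ≠ 0)
    (hA : ‖Matrix.toEuclideanCLM (𝕜 := ℝ) A‖ < 1) (n : ℕ) (α : Fin d → ℤ) :
    MeasurableSet (pulledCubes A c n α) := by
  rw [pulledCubes_eq hdet]
  exact measurable_cubeCode hℓ hA c n (measurableSet_singleton α)

lemma partEntropy_pulledCubes (hℓ : 1 ≤ ℓ) (hdet : A.det ≠ 0)
    (hA : ‖Matrix.toEuclideanCLM (𝕜 := ℝ) A‖ < 1) (n : ℕ) :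
    partEntropy m (pulledCubes A c n) = finEntropy ⊥ m (finCode hs n) := by
  rw [partEntropy, condEntropy_eq_sum bot_le (fun α => pulledCubes_eq_empty hs hdet)
    (measurableSet_pulledCubes hℓ hdet hA n), ← Finset.sum_coe_sort, finEntropy]
  refine Finset.sum_congr rfl fun α _ => ?_
  rw [finCode_preimage hs hdet]

lemma codingSigma_le (hℓ : 1 ≤ ℓ) (hA : ‖Matrix.toEuclideanCLM (𝕜 := ℝ) A‖ < 1) :
    codingSigma (affineIFS A c) ≤ (inferInstance : MeasurableSpace (ShiftSpace ℓ)) := by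
  rw [codingSigma_eq]
  exact (continuous_codingMap_affineIFS hℓ hA c).measurable.comap_le

lemma comap_leftShift_codingSigma_le (hℓ : 1 ≤ ℓ) (hA : ‖Matrix.toEuclideanCLM (𝕜 := ℝ) A‖ < 1) :
    (codingSigma (affineIFS A c)).comap leftShift ≤
      (inferInstance : MeasurableSpace (ShiftSpace ℓ)) :=
  (MeasurableSpace.comap_mono (codingSigma_le hℓ hA)).trans measurable_leftShift.comap_le

lemma measurableSet_cylinderOne (j : Fin ℓ) : MeasurableSet (cylinderOne j) := by
  have h : Measurable fun x : ShiftSpace ℓ => x 0 := measurable_pi_apply 0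
  exact h (measurableSet_singleton j)

lemma projEntropy_eq (hℓ : 1 ≤ ℓ) (hA : ‖Matrix.toEuclideanCLM (𝕜 := ℝ) A‖ < 1) :
    projEntropy (affineIFS A c) m =
      finEntropy ((codingSigma (affineIFS A c)).comap leftShift) m (fun x => x 0) -
        finEntropy (codingSigma (affineIFS A c)) m fun x => x 0 := by
  rw [projEntropy, condEntropy_eq_sum (s := Finset.univ) (comap_leftShift_codingSigma_le hℓ hA)
    (by simp) measurableSet_cylinderOne, condEntropy_eq_sum (s := Finset.univ)
    (codingSigma_le hℓ hA) (by simp) measurableSet_cylinderOne]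
  rfl

lemma projEntropy_le_log (hℓ : 1 ≤ ℓ) (hA : ‖Matrix.toEuclideanCLM (𝕜 := ℝ) A‖ < 1) :
    projEntropy (affineIFS A c) m ≤ Real.log ℓ := by
  have : Nonempty (Fin ℓ) := ⟨⟨0, hℓ⟩⟩
  have h1 := finEntropy_le_log_card (m := m) (comap_leftShift_codingSigma_le (c := c) hℓ hA)
    (f := fun x => x 0) (measurable_pi_apply 0)
  have h2 := finEntropy_nonneg (m := m) (codingSigma_le (c := c) hℓ hA)
    (f := fun x => x 0) measurableSet_cylinderOne
  rw [Fintype.card_fin] at h1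
  rw [projEntropy_eq hℓ hA]
  linarith

lemma measurable_finCode_codingSigma (n : ℕ) :
    Measurable[codingSigma (affineIFS A c)] (finCode hs n) := by
  rw [codingSigma_eq]
  exact Measurable.subtype_mk (measurable_cubeCode_comap c n)

theorem tendsto_finEntropy_finCode_div (hℓ : 1 ≤ ℓ) (hdet : A.det ≠ 0)
    (hA : ‖Matrix.toEuclideanCLM (𝕜 := ℝ) A‖ < 1) (hm : MeasurePreserving leftShift m m) :
    Tendsto (fun n : ℕ => finEntropy ⊥ m (finCode hs n) / n) atTop
      (𝓝 (projEntropy (affineIFS A c) m)) := by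
  rw [projEntropy_eq hℓ hA]
  -- Transfers cardinality bounds from indices in `ℤ^d` to the subtype `s n` in which `finCode`
  -- takes its values.
  have hcard : ∀ {n n' : ℕ} {T : Set (s n)} {T' : Set (Fin d → ℤ)}, T'.ncard ≤ 2 ^ d →
      T' ⊆ range (cubeCode A c n') → (∀ α ∈ T, (α : Fin d → ℤ) ∈ T') → T.ncard ≤ 2 ^ d := by
    intro n n' T T' hT' hfin h
    refine le_trans ?_ hT'
    rw [← Set.ncard_image_of_injective T Subtype.val_injective]
    refine Set.ncard_le_ncard ?_ ((finite_range_cubeCode hℓ hA c n').subset hfin)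
    rintro _ ⟨α, hα, rfl⟩
    exact h α hα
  refine tendsto_finEntropy_div hm (measurable_pi_apply 0)
    (continuous_codingMap_affineIFS hℓ hA c).measurable (codingSigma_eq c)
    (codingSigma_sup_comap_prefixWord hℓ hdet hA c) (codingSigma_sup_comap_zero hℓ hdet hA c)
    (measurable_finCode_codingSigma hs) ?_ (C := 2 ^ d) (by positivity) ?_ ?_
  · intro ε hε
    filter_upwards [eventually_dist_codingMap_lt hdet hA c hε] with n hn x y hxy
    exact hn x y ((finCode_eq_iff hs).1 hxy)
  · intro k n w β
    refine hcard (n' := n + k) (ncard_cubeCode_add_le hℓ hdet hA c k n w β).1 ?_ ?_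
    · rintro _ ⟨x, rfl, -⟩
      exact mem_range_self x
    · rintro _ ⟨x, rfl, hx, hx'⟩
      exact ⟨x, rfl, hx, (finCode_eq_iff hs).1 hx'⟩
  · intro k n w β
    refine hcard (n' := n) (ncard_cubeCode_add_le hℓ hdet hA c k n w β).2 ?_ ?_
    · rintro _ ⟨x, rfl, -⟩
      exact mem_range_self _
    · rintro _ ⟨x, rfl, hx, hx'⟩
      exact ⟨x, rfl, hx, (finCode_eq_iff hs).1 hx'⟩

end Measure

lemma ncard_meetingCubes
    (hs : ∀ n, (s n : Set (Fin d → ℤ)) = range (cubeCode A c n)) (hℓ : 1 ≤ ℓ) (hdet : A.det ≠ 0)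
    (hA : ‖Matrix.toEuclideanCLM (𝕜 := ℝ) A‖ < 1) (n : ℕ) :
    (meetingCubes A c n).ncard = (s n).card := by
  rw [meetingCubes_eq hℓ hdet hA, Set.ncard_image_of_injective _ unitCube_injective, ← hs n,
    Set.ncard_coe_finset]

end ProjectionEntropy

/-! ### Entropy from below by the largest atom. -/

section EntropyLowerBound

/-- Each atom of positive mass has information at least `-log M`, and the masses sum to one. -/
lemma neg_log_le_finEntropy_bot {Ω ι : Type*} [MeasurableSpace Ω] {m : Measure Ω}
    [IsProbabilityMeasure m] [Fintype ι] {f : Ω → ι} (hf : ∀ i, MeasurableSet (f ⁻¹' {i})) {M : ℝ}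
    (hM : ∀ i, m.real (f ⁻¹' {i}) ≤ M) : -Real.log M ≤ finEntropy ⊥ m f := by
  have hp : ∀ i, ∫ x, (f ⁻¹' {i}).indicator (fun _ => (1 : ℝ)) x ∂m = m.real (f ⁻¹' {i}) := fun i => by
    rw [integral_indicator (hf i), setIntegral_const, smul_eq_mul, mul_one]
  have hsum : ∑ i, m.real (f ⁻¹' {i}) = 1 := by
    rw [sum_measureReal_preimage_singleton Finset.univ fun i _ => hf i]
    simp
  rw [finEntropy_bot]
  calc -Real.log M = ∑ i, m.real (f ⁻¹' {i}) * -Real.log M := by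
        rw [← Finset.sum_mul, hsum, one_mul]
    _ ≤ _ := Finset.sum_le_sum fun i _ => by
        rw [hp, Real.negMulLog, neg_mul, mul_neg, neg_le_neg_iff]
        rcases (measureReal_nonneg (μ := m) (s := f ⁻¹' {i})).eq_or_lt with h0 | h0
        · rw [← h0, zero_mul, zero_mul]
        · exact mul_le_mul_of_nonneg_left (Real.log_le_log h0 (hM i)) h0.le

end EntropyLowerBound

/-! ### Concatenated blocks and averaging over shifts. -/

section BlockMeasure

variable {J : Type*} {ℓ : ℕ}

/-- The concatenation of the blocks of length `n` given by the first `n` symbols of the sequences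
`W (y 0)`, `W (y 1)`, …. -/
def concatBlocks (n : ℕ) (W : J → ShiftSpace ℓ) (y : ℕ → J) : ShiftSpace ℓ :=
  fun k => W (y (k / n)) (k % n)

lemma leftShift_iterate_concatBlocks {n : ℕ} (hn : 0 < n) (W : J → ShiftSpace ℓ) (y : ℕ → J) :
    leftShift^[n] (concatBlocks n W y) = concatBlocks n W fun i => y (i + 1) := by
  funext k
  rw [leftShift_iterate_apply, concatBlocks, concatBlocks, Nat.add_div_right k hn, Nat.add_mod_right]

lemma prefixWord_concatBlocks (n : ℕ) (W : J → ShiftSpace ℓ) (y : ℕ → J) :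
    prefixWord n (concatBlocks n W y) = prefixWord n (W (y 0)) := by
  funext i
  rw [prefixWord_apply, prefixWord_apply, concatBlocks, Nat.div_eq_of_lt i.2, Nat.mod_eq_of_lt i.2]

variable [MeasurableSpace J]

lemma measurable_concatBlocks [Countable J] [MeasurableSingletonClass J] (n : ℕ)
    (W : J → ShiftSpace ℓ) : Measurable (concatBlocks n W) :=
  measurable_pi_lambda _ fun k =>
    (measurable_of_countable fun a => W a (k % n)).comp (measurable_pi_apply (k / n))

lemma measurePreserving_shift_infinitePi (u : Measure J) [IsProbabilityMeasure u] :
    MeasurePreserving (fun (y : ℕ → J) i => y (i + 1)) (Measure.infinitePi fun _ : ℕ => u)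
      (Measure.infinitePi fun _ : ℕ => u) := by
  have hmeas : Measurable fun (y : ℕ → J) i => y (i + 1) :=
    measurable_pi_lambda _ fun i => measurable_pi_apply (i + 1)
  refine ⟨hmeas, Measure.eq_infinitePi _ fun s t ht => ?_⟩
  rw [Measure.map_apply hmeas (MeasurableSet.pi s.countable_toSet fun i _ => ht i)]
  -- The truncated `i - 1` is evaluated only at shifted indices `i ≥ 1`.
  have h : (fun (y : ℕ → J) i => y (i + 1)) ⁻¹' Set.pi s t =
      Set.pi (s.map (addRightEmbedding 1)) fun i => t (i - 1) := by
    ext y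
    simp [Set.mem_pi]
  rw [h, Measure.infinitePi_pi _ fun i _ => ht _, Finset.prod_map]
  simp

lemma infinitePi_forall_fin_eq (u : Measure J) [IsProbabilityMeasure u] [MeasurableSingletonClass J]
    {p : ℝ≥0∞} (hp : ∀ a, u {a} = p) (N : ℕ) (v : Fin N → J) :
    Measure.infinitePi (fun _ : ℕ => u) {y | ∀ i : Fin N, y i = v i} = p ^ N := by
  classical
  have h : {y : ℕ → J | ∀ i : Fin N, y i = v i} =
      Set.pi (Finset.range N) fun i => if h : i < N then {v ⟨i, h⟩} else univ := by
    ext y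
    simp only [mem_ofPred_eq, Set.mem_pi, Finset.coe_range, mem_Iio]
    constructor
    · intro hy i hi
      rw [dif_pos hi]
      exact hy ⟨i, hi⟩
    · intro hy i
      have := hy i i.2
      rwa [dif_pos i.2] at this
  rw [h, Measure.infinitePi_pi]
  · rw [Finset.prod_congr rfl (g := fun _ => p), Finset.prod_const, Finset.card_range]
    intro i hi
    rw [dif_pos (Finset.mem_range.1 hi), hp]
  · intro i hi
    rw [dif_pos (Finset.mem_range.1 hi)]
    exact measurableSet_singleton _

/-- The average of the images of a measure under the first `n` iterates of the shift. -/
noncomputable def shiftAverage (n : ℕ) (μ : Measure (ShiftSpace ℓ)) : Measure (ShiftSpace ℓ) :=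
  (n : ℝ≥0∞)⁻¹ • ∑ i ∈ Finset.range n, μ.map leftShift^[i]

lemma shiftAverage_mem_invariantMeasures {n : ℕ} (hn : 0 < n) {μ : Measure (ShiftSpace ℓ)}
    [IsProbabilityMeasure μ] (hμ : μ.map leftShift^[n] = μ) :
    shiftAverage n μ ∈ invariantMeasures ℓ := by
  have hT : ∀ i, Measurable (leftShift (ℓ := ℓ))^[i] := fun i => measurable_leftShift.iterate i
  refine ⟨⟨?_⟩, measurable_leftShift, ?_⟩
  · have h1 : ∀ i, μ.map leftShift^[i] univ = 1 := fun i => by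
      rw [Measure.map_apply (hT i) MeasurableSet.univ, preimage_univ, measure_univ]
    simp only [shiftAverage, Measure.smul_apply, Measure.finsetSum_apply, h1, smul_eq_mul,
      Finset.sum_const, Finset.card_range, nsmul_eq_mul, mul_one]
    exact ENNReal.inv_mul_cancel (by exact_mod_cast hn.ne') (ENNReal.natCast_ne_top n)
  · rw [shiftAverage, Measure.map_smul, Measure.map_finset_sum measurable_leftShift.aemeasurable]
    congr 1
    have h1 : ∀ i, (μ.map leftShift^[i]).map leftShift = μ.map leftShift^[i + 1] := fun i => by
      rw [Measure.map_map measurable_leftShift (hT i), Function.iterate_succ']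
    simp only [h1]
    -- The sum of the first `n + 1` images is split at its last and at its first term. Both of these
    -- equal `μ`, so cancelling it leaves the shifted sum equal to the original one.
    have h2 := Finset.sum_range_succ (fun i => μ.map leftShift^[i]) n
    have h3 := Finset.sum_range_succ' (fun i => μ.map leftShift^[i]) n
    rw [h3, hμ] at h2
    simp only [Function.iterate_zero, Measure.map_id] at h2
    exact (Measure.add_left_inj μ _ _).1 h2

lemma shiftAverage_le {n : ℕ} {μ : Measure (ShiftSpace ℓ)} {S : Set (ShiftSpace ℓ)} {B : ℝ≥0∞}
    (hB : ∀ i < n, μ.map leftShift^[i] S ≤ B) : shiftAverage n μ S ≤ B := by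
  rw [shiftAverage, Measure.smul_apply, Measure.finsetSum_apply, smul_eq_mul]
  calc (n : ℝ≥0∞)⁻¹ * ∑ i ∈ Finset.range n, μ.map leftShift^[i] S
      ≤ (n : ℝ≥0∞)⁻¹ * ∑ _i ∈ Finset.range n, B := by
        gcongr with i hi
        exact hB i (Finset.mem_range.1 hi)
    _ = ((n : ℝ≥0∞)⁻¹ * n) * B := by
        rw [Finset.sum_const, Finset.card_range, nsmul_eq_mul, mul_assoc]
    _ ≤ B := mul_le_of_le_one_left' (ENNReal.inv_mul_le_one _)

end BlockMeasure

/-! ### How many block sequences lead into a small set. -/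

section Counting

variable {d ℓ : ℕ} {A : Matrix (Fin d) (Fin d) ℝ} {c : Fin ℓ → EuclideanSpace ℝ (Fin d)}

lemma linPow_linPowInv_add (hdet : A.det ≠ 0) (n k : ℕ) (y : EuclideanSpace ℝ (Fin d)) :
    linPow A k (linPowInv A (k + n) y) = linPowInv A n y := by
  conv_rhs => rw [← linPow_linPowInv hdet (k + n) y, add_comm k n, linPow_add_apply,
    linPowInv_linPow hdet]
  rw [add_comm k n]

lemma linPowInv_linPow_comm (hdet : A.det ≠ 0) (n k : ℕ) (y : EuclideanSpace ℝ (Fin d)) :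
    linPowInv A n (linPow A k y) = linPow A k (linPowInv A n y) := by
  conv_lhs => rw [← linPow_linPowInv hdet n y, ← linPow_add_apply, add_comm, linPow_add_apply,
    linPowInv_linPow hdet]

lemma exists_dist_codingMap_le (hℓ : 1 ≤ ℓ) (hA : ‖Matrix.toEuclideanCLM (𝕜 := ℝ) A‖ < 1)
    (c : Fin ℓ → EuclideanSpace ℝ (Fin d)) :
    ∃ R : ℝ, ∀ x y : ShiftSpace ℓ,
      dist (codingMap (affineIFS A c) x) (codingMap (affineIFS A c) y) ≤ R := by
  obtain ⟨R, hR⟩ := Metric.isBounded_iff.1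
    (isCompact_range (continuous_codingMap_affineIFS hℓ hA c)).isBounded
  exact ⟨R, fun x y => hR ⟨x, rfl⟩ ⟨y, rfl⟩⟩

lemma dist_linPowInv_codingMap_eq (hℓ : 1 ≤ ℓ) (hdet : A.det ≠ 0)
    (hA : ‖Matrix.toEuclideanCLM (𝕜 := ℝ) A‖ < 1) {n : ℕ} {x y : ShiftSpace ℓ}
    (h : prefixWord n x = prefixWord n y) :
    dist (linPowInv A n (codingMap (affineIFS A c) x))
        (linPowInv A n (codingMap (affineIFS A c) y)) =
      dist (codingMap (affineIFS A c) (leftShift^[n] x))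
        (codingMap (affineIFS A c) (leftShift^[n] y)) := by
  rw [codingMap_eq_linPow_add hℓ hA c n x, codingMap_eq_linPow_add hℓ hA c n y, h, map_add, map_add,
    dist_add_right, linPowInv_linPow hdet, linPowInv_linPow hdet]

variable {J : Type*}

/-- If the sequences `W a` code points in different elements of `𝒬_n`, then a set of small diameter
meets `A ^ (-n)` of boundedly many of the cylinders given by their first `n` symbols. -/
lemma ncard_first_block_le (hℓ : 1 ≤ ℓ) (hdet : A.det ≠ 0)
    (hA : ‖Matrix.toEuclideanCLM (𝕜 := ℝ) A‖ < 1) {R δ : ℝ} {r : ℕ} (hr : R + δ + R ≤ r)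
    (hR : ∀ x y : ShiftSpace ℓ,
      dist (codingMap (affineIFS A c) x) (codingMap (affineIFS A c) y) ≤ R)
    {n : ℕ} {W : J → ShiftSpace ℓ} (hW : Function.Injective fun a => cubeCode A c n (W a))
    {D : Set (EuclideanSpace ℝ (Fin d))} (hD : ∀ y ∈ D, ∀ z ∈ D, dist y z ≤ δ) :
    {a | ∃ y, y 0 = a ∧
      linPowInv A n (codingMap (affineIFS A c) (concatBlocks n W y)) ∈ D}.ncard ≤
        (2 * r + 1) ^ d := by
  -- The concatenation and `W (y 0)` share `n` symbols, so after rescaling by `A^{-n}` their points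
  -- are within `R`. Hence `W (y 0)` lands in the `R`-neighbourhood of `D`, of diameter at most `R +
  -- δ + R`, and different blocks lie in different cubes.
  set D' : Set (EuclideanSpace ℝ (Fin d)) := {z | ∃ z' ∈ D, dist z z' ≤ R} with hD'
  have hdiam : ∀ y ∈ D', ∀ z ∈ D', dist y z ≤ r := by
    rintro y ⟨y', hy', hyy'⟩ z ⟨z', hz', hzz'⟩
    have h1 := dist_triangle4 y y' z' z
    have h2 := hD y' hy' z' hz'
    rw [dist_comm z' z] at h1
    linarith
  refine le_trans ?_ (ncard_cubeIndex_image_le hdiam)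
  rw [← Set.ncard_image_of_injective _ hW]
  refine Set.ncard_le_ncard ?_ (finite_cubeIndex_image
    (Metric.isBounded_iff.2 ⟨r, fun y hy z hz => hdiam y hy z hz⟩))
  rintro _ ⟨a, ⟨y, rfl, hy⟩, rfl⟩
  refine ⟨_, ⟨_, hy, ?_⟩, rfl⟩
  rw [dist_linPowInv_codingMap_eq hℓ hdet hA (prefixWord_concatBlocks n W y).symm]
  exact hR _ _

variable [Fintype J]

/-- Induction on the number of blocks. Applying `A^{nN}` does not increase the diameter of `D`, so
the first block has at most `C` possibilities; once it is fixed, the remaining blocks lead into a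
translate of `D`. The diameter bound `δ` survives both operations, so the same `C` serves every
step. -/
lemma ncard_blocks_le (hℓ : 1 ≤ ℓ) (hdet : A.det ≠ 0)
    (hA : ‖Matrix.toEuclideanCLM (𝕜 := ℝ) A‖ < 1) {δ : ℝ} {C n : ℕ} (hn : 0 < n)
    {W : J → ShiftSpace ℓ}
    (hC : ∀ D : Set (EuclideanSpace ℝ (Fin d)), (∀ y ∈ D, ∀ z ∈ D, dist y z ≤ δ) →
      {a | ∃ y, y 0 = a ∧
        linPowInv A n (codingMap (affineIFS A c) (concatBlocks n W y)) ∈ D}.ncard ≤ C)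
    (N : ℕ) : ∀ D : Set (EuclideanSpace ℝ (Fin d)), (∀ y ∈ D, ∀ z ∈ D, dist y z ≤ δ) →
      {v : Fin N → J | ∃ y : ℕ → J, (∀ i : Fin N, y i = v i) ∧
        linPowInv A (n * N) (codingMap (affineIFS A c) (concatBlocks n W y)) ∈ D}.ncard ≤ C ^ N := by
  classical
  induction N with
  | zero =>
    intro D _
    refine (Set.ncard_le_card _).trans ?_
    simp
  | succ N ih =>
    intro D hD
    set F := {v : Fin (N + 1) → J | ∃ y : ℕ → J, (∀ i : Fin (N + 1), y i = v i) ∧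
        linPowInv A (n * (N + 1)) (codingMap (affineIFS A c) (concatBlocks n W y)) ∈ D} with hF
    have himage : ((fun v => v 0) '' F).ncard ≤ C := by
      refine le_trans (Set.ncard_le_ncard ?_ (Set.toFinite _)) (hC (linPow A (n * N) '' D) ?_)
      · rintro _ ⟨v, ⟨y, hy, hyD⟩, rfl⟩
        exact ⟨y, hy 0, _, hyD, linPow_linPowInv_add hdet n (n * N) _⟩
      · rintro _ ⟨y, hy, rfl⟩ _ ⟨z, hz, rfl⟩
        exact (dist_linPow_le hA _ y z).trans (hD y hy z hz)
    have hfiber : ∀ a, {v ∈ F | v 0 = a}.ncard ≤ C ^ N := by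
      intro a
      set t := linPowInv A (n * N + n) (wordTranslation A c n (prefixWord n (W a)))
      have htail : InjOn (Fin.tail : (Fin (N + 1) → J) → Fin N → J) {v ∈ F | v 0 = a} := by
        rintro v ⟨-, hv⟩ w ⟨-, hw⟩ hvw
        rw [← Fin.cons_self_tail v, ← Fin.cons_self_tail w, hvw, hv, hw]
      rw [← htail.ncard_image]
      refine le_trans (Set.ncard_le_ncard ?_ (Set.toFinite _)) (ih {z | z + t ∈ D} ?_)
      · rintro _ ⟨v, ⟨⟨y, hy, hyD⟩, hva⟩, rfl⟩
        refine ⟨fun i => y (i + 1), fun i => hy i.succ, ?_⟩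
        have h0 : y 0 = a := (hy 0).trans hva
        have h1 := linPowInv_codingMap hℓ hdet hA c (n * N) n (concatBlocks n W y)
        rw [leftShift_iterate_concatBlocks hn, prefixWord_concatBlocks, h0] at h1
        rw [mem_ofPred_eq, ← h1]
        exact hyD
      · intro y hy z hz
        rw [← dist_add_right y z t]
        exact hD _ hy _ hz
    have hmul := Finset.card_le_mul_card_image (f := fun v : Fin (N + 1) → J => v 0) F.toFinset (C ^ N)
      fun a _ => by
        rw [← Set.ncard_coe_finset]
        refine le_trans (le_of_eq ?_) (hfiber a)
        congr 1
        ext v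
        simp
    rw [Set.ncard_eq_toFinset_card', pow_succ]
    refine hmul.trans (Nat.mul_le_mul_left _ ?_)
    refine le_trans (le_of_eq ?_) himage
    rw [← Set.ncard_coe_finset]
    congr 1
    simp

variable [MeasurableSpace J] [MeasurableSingletonClass J]

/-- The law of the concatenation of independent blocks of length `n`, each of them uniformly
distributed over the first `n` symbols of the sequences `W a`. -/
noncomputable def blockMeasure (n : ℕ) (W : J → ShiftSpace ℓ) : Measure (ShiftSpace ℓ) :=
  (Measure.infinitePi fun _ : ℕ => ProbabilityTheory.uniformOn (univ : Set J)).map (concatBlocks n W)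

lemma uniformOn_univ_singleton (a : J) :
    ProbabilityTheory.uniformOn (univ : Set J) {a} = (Fintype.card J : ℝ≥0∞)⁻¹ := by
  rw [ProbabilityTheory.uniformOn_univ, Measure.count_singleton, one_div]

variable [Nonempty J]

instance isProbabilityMeasure_uniformOn_univ :
    IsProbabilityMeasure (ProbabilityTheory.uniformOn (univ : Set J)) :=
  ProbabilityTheory.isProbabilityMeasure_uniformOn finite_univ univ_nonempty

instance isProbabilityMeasure_blockMeasure (n : ℕ) (W : J → ShiftSpace ℓ) :
    IsProbabilityMeasure (blockMeasure n W) :=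
  Measure.isProbabilityMeasure_map (measurable_concatBlocks n W).aemeasurable

lemma map_blockMeasure {n : ℕ} (hn : 0 < n) (W : J → ShiftSpace ℓ) :
    (blockMeasure n W).map leftShift^[n] = blockMeasure n W := by
  have h := measurePreserving_shift_infinitePi (ProbabilityTheory.uniformOn (univ : Set J))
  rw [blockMeasure, Measure.map_map (measurable_leftShift.iterate n) (measurable_concatBlocks n W)]
  conv_rhs => rw [← h.map_eq, Measure.map_map (measurable_concatBlocks n W) h.measurable]
  congr 1
  funext y
  exact leftShift_iterate_concatBlocks hn W y

/-- Union bound over the compatible choices of `N` blocks, each of probability `(card J)^{-N}`. -/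
lemma blockMeasure_le (hℓ : 1 ≤ ℓ) (hA : ‖Matrix.toEuclideanCLM (𝕜 := ℝ) A‖ < 1) {C n N : ℕ}
    {W : J → ShiftSpace ℓ} {D : Set (EuclideanSpace ℝ (Fin d))} (hDm : MeasurableSet D)
    (hC : {v : Fin N → J | ∃ y : ℕ → J, (∀ i : Fin N, y i = v i) ∧
        linPowInv A (n * N) (codingMap (affineIFS A c) (concatBlocks n W y)) ∈ D}.ncard ≤ C) :
    blockMeasure n W {x | linPowInv A (n * N) (codingMap (affineIFS A c) x) ∈ D} ≤
      C * (Fintype.card J : ℝ≥0∞)⁻¹ ^ N := by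
  classical
  set F := {v : Fin N → J | ∃ y : ℕ → J, (∀ i : Fin N, y i = v i) ∧
        linPowInv A (n * N) (codingMap (affineIFS A c) (concatBlocks n W y)) ∈ D} with hF
  have hmeas : MeasurableSet {x : ShiftSpace ℓ |
      linPowInv A (n * N) (codingMap (affineIFS A c) x) ∈ D} :=
    ((linPowInv A (n * N)).continuous.comp
      (continuous_codingMap_affineIFS hℓ hA c)).measurable hDm
  rw [blockMeasure, Measure.map_apply (measurable_concatBlocks n W) hmeas]
  calc _ ≤ (Measure.infinitePi fun _ : ℕ => ProbabilityTheory.uniformOn (univ : Set J))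
        (⋃ v ∈ F.toFinset, {y | ∀ i : Fin N, y i = v i}) := by
        refine measure_mono fun y hy => ?_
        simp only [mem_iUnion]
        exact ⟨fun i => y i, mem_toFinset.2 ⟨y, fun _ => rfl, hy⟩, fun _ => rfl⟩
    _ ≤ ∑ v ∈ F.toFinset, (Measure.infinitePi fun _ : ℕ =>
          ProbabilityTheory.uniformOn (univ : Set J)) {y | ∀ i : Fin N, y i = v i} :=
        measure_biUnion_finset_le _ _
    _ = F.ncard * (Fintype.card J : ℝ≥0∞)⁻¹ ^ N := by
        simp only [infinitePi_forall_fin_eq _ uniformOn_univ_singleton, Finset.sum_const,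
          nsmul_eq_mul, Set.ncard_eq_toFinset_card']
    _ ≤ C * (Fintype.card J : ℝ≥0∞)⁻¹ ^ N := by
        gcongr

/-- A shift by `i` breaks the block structure. Splitting over the `ℓ^i` prefixes `w` restores it:
the condition on `σ^i x` becomes that the rescaled point of `x` lies in `D w`, a translate of `A^i`
of a unit cube, still of diameter at most `√d`. -/
lemma map_iterate_blockMeasure_le (hℓ : 1 ≤ ℓ) (hdet : A.det ≠ 0)
    (hA : ‖Matrix.toEuclideanCLM (𝕜 := ℝ) A‖ < 1) {C n N : ℕ} {W : J → ShiftSpace ℓ}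
    (hC : ∀ D : Set (EuclideanSpace ℝ (Fin d)), (∀ y ∈ D, ∀ z ∈ D, dist y z ≤ √d) →
      {v : Fin N → J | ∃ y : ℕ → J, (∀ i : Fin N, y i = v i) ∧
        linPowInv A (n * N) (codingMap (affineIFS A c) (concatBlocks n W y)) ∈ D}.ncard ≤ C)
    (i : ℕ) (β : Fin d → ℤ) :
    (blockMeasure n W).map leftShift^[i] (cubeCode A c (n * N) ⁻¹' {β}) ≤
      ℓ ^ i * (C * (Fintype.card J : ℝ≥0∞)⁻¹ ^ N) := by
  set D : (Fin i → Fin ℓ) → Set (EuclideanSpace ℝ (Fin d)) := fun w =>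
    {z | cubeIndex (linPowInv A i (z - linPowInv A (n * N) (wordTranslation A c i w))) = β} with hD
  have hDm : ∀ w, MeasurableSet (D w) := fun w => by
    have : Measurable fun z => cubeIndex
        (linPowInv A i (z - linPowInv A (n * N) (wordTranslation A c i w))) :=
      measurable_cubeIndex.comp ((linPowInv A i).continuous.measurable.comp
        (measurable_id.sub_const _))
    exact this (measurableSet_singleton β)
  have hdiam : ∀ w, ∀ y ∈ D w, ∀ z ∈ D w, dist y z ≤ √d := by
    intro w y hy z hz
    rw [← dist_sub_right y z (linPowInv A (n * N) (wordTranslation A c i w)),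
      ← linPow_linPowInv hdet i (y - _), ← linPow_linPowInv hdet i (z - _)]
    exact (dist_linPow_le hA i _ _).trans (dist_le_sqrt_of_cubeIndex_eq (hy.trans hz.symm))
  rw [Measure.map_apply (measurable_leftShift.iterate i)
    (measurable_cubeCode hℓ hA c (n * N) (measurableSet_singleton β))]
  calc _ ≤ blockMeasure n W
        (⋃ w, {x | linPowInv A (n * N) (codingMap (affineIFS A c) x) ∈ D w}) := by
        refine measure_mono fun x hx => mem_iUnion.2 ⟨prefixWord i x, ?_⟩
        rw [mem_ofPred_eq, hD, mem_ofPred_eq, ← map_sub]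
        conv_lhs => rw [codingMap_eq_linPow_add hℓ hA c i x, add_sub_cancel_right,
          linPowInv_linPow_comm hdet, linPowInv_linPow hdet]
        exact hx
    _ ≤ ∑ w, blockMeasure n W {x | linPowInv A (n * N) (codingMap (affineIFS A c) x) ∈ D w} :=
        measure_iUnion_fintype_le _ _
    _ ≤ ∑ _w : Fin i → Fin ℓ, (C * (Fintype.card J : ℝ≥0∞)⁻¹ ^ N) :=
        Finset.sum_le_sum fun w _ => blockMeasure_le hℓ hA (hDm w) (hC (D w) (hdiam w))
    _ = ℓ ^ i * (C * (Fintype.card J : ℝ≥0∞)⁻¹ ^ N) := by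
        rw [Finset.sum_const, nsmul_eq_mul, Finset.card_univ, Fintype.card_fun, Fintype.card_fin,
          Fintype.card_fin]
        push_cast
        rfl

end Counting

/-! ### The variational principle. -/

section Variational

variable {d ℓ : ℕ} {A : Matrix (Fin d) (Fin d) ℝ} {c : Fin ℓ → EuclideanSpace ℝ (Fin d)}
  {s : ℕ → Finset (Fin d → ℤ)}

lemma nonempty_finset_of_coe_eq_range (hℓ : 1 ≤ ℓ)
    (hs : ∀ n, (s n : Set (Fin d → ℤ)) = range (cubeCode A c n)) (n : ℕ) : (s n).Nonempty := by
  rw [← Finset.coe_nonempty, hs n]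
  exact ⟨_, fun _ => ⟨0, hℓ⟩, rfl⟩

/-- The constant must not depend on `n`, so that it disappears after division by `n`. -/
lemma exists_invariantMeasure_le_projEntropy (hℓ : 1 ≤ ℓ) (hdet : A.det ≠ 0)
    (hA : ‖Matrix.toEuclideanCLM (𝕜 := ℝ) A‖ < 1)
    (hs : ∀ n, (s n : Set (Fin d → ℤ)) = range (cubeCode A c n)) :
    ∃ C : ℝ, ∀ n : ℕ, 0 < n → ∃ m ∈ invariantMeasures ℓ,
      (Real.log (s n).card - C) / n ≤ projEntropy (affineIFS A c) m := by
  obtain ⟨R, hR⟩ := exists_dist_codingMap_le hℓ hA c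
  -- A unit cube has diameter at most `√d` and is thickened by the diameter bound `R` of the
  -- attractor on both sides; `C` bounds the number of cubes met by the result.
  obtain ⟨r, hr⟩ := exists_nat_ge (R + √d + R)
  set C : ℕ := (2 * r + 1) ^ d with hCdef
  have hC0 : (0 : ℝ) < C := by positivity
  refine ⟨Real.log C, fun n hn => ?_⟩
  have hne := nonempty_finset_of_coe_eq_range hℓ hs n
  have : Nonempty (s n) := hne.to_subtype
  have hcard0 : (0 : ℝ) < (s n).card := by exact_mod_cast hne.card_pos
  have hℓ0 : (0 : ℝ) < ℓ := by exact_mod_cast hℓ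
  have hn0 : (0 : ℝ) < n := by exact_mod_cast hn
  have hW : ∀ α : s n, ∃ x : ShiftSpace ℓ, cubeCode A c n x = α := fun α => by
    have := α.2
    rwa [← Finset.mem_coe, hs n] at this
  choose W hW using hW
  have hWinj : Function.Injective fun a => cubeCode A c n (W a) := by
    intro a b hab
    simp only [hW] at hab
    exact Subtype.ext hab
  have hblocks := ncard_blocks_le (δ := √d) (C := C) (W := W) hℓ hdet hA hn fun D hD =>
    ncard_first_block_le hℓ hdet hA hr hR hWinj hD
  have hm := shiftAverage_mem_invariantMeasures hn (map_blockMeasure hn W)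
  refine ⟨_, hm, ?_⟩
  set m := shiftAverage n (blockMeasure n W) with hm_def
  have : IsProbabilityMeasure m := hm.1
  have hbound : ∀ N : ℕ, ∀ β : s (n * N), m.real (finCode hs (n * N) ⁻¹' {β}) ≤
      ℓ ^ n * (C ^ N * ((s n).card : ℝ)⁻¹ ^ N) := by
    intro N β
    have h1 : m (cubeCode A c (n * N) ⁻¹' {(β : Fin d → ℤ)}) ≤
        ℓ ^ n * ((C ^ N : ℕ) * (Fintype.card (s n) : ℝ≥0∞)⁻¹ ^ N) := by
      refine shiftAverage_le fun i hi =>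
        (map_iterate_blockMeasure_le hℓ hdet hA (hblocks N) i β).trans ?_
      gcongr
      exact_mod_cast hℓ
    rw [finCode_preimage hs hdet, pulledCubes_eq hdet, measureReal_def]
    refine (ENNReal.toReal_mono ?_ h1).trans (le_of_eq ?_)
    · refine ENNReal.mul_ne_top (by finiteness) (ENNReal.mul_ne_top (by finiteness) ?_)
      refine ENNReal.pow_ne_top (ENNReal.inv_ne_top.2 ?_)
      exact_mod_cast Fintype.card_ne_zero
    · simp
  have hent : ∀ N : ℕ, N * (Real.log (s n).card - Real.log C) - n * Real.log ℓ ≤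
      finEntropy ⊥ m (finCode hs (n * N)) := by
    intro N
    refine le_trans (le_of_eq ?_) (neg_log_le_finEntropy_bot (fun β => ?_) (hbound N))
    · rw [Real.log_mul (by positivity) (by positivity), Real.log_mul (by positivity) (by positivity),
        Real.log_pow, Real.log_pow, Real.log_pow, Real.log_inv]
      ring
    · rw [finCode_preimage hs hdet]
      exact measurableSet_pulledCubes hℓ hdet hA _ _
  -- By part (i) the projection entropy may be computed along the multiples `n * N`, where `hent`
  -- applies; its loss `n log ℓ` becomes `log ℓ / N`.
  have hlim := (tendsto_finEntropy_finCode_div hs hℓ hdet hA hm.2).comp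
    (tendsto_id.const_mul_atTop' hn)
  have hlim' : Tendsto (fun N : ℕ => (Real.log (s n).card - Real.log C) / n -
      Real.log ℓ / N) atTop (𝓝 ((Real.log (s n).card - Real.log C) / n)) := by
    simpa using (tendsto_const_div_atTop_nhds_zero_nat (Real.log ℓ)).const_sub
      ((Real.log (s n).card - Real.log C) / n)
  refine le_of_tendsto_of_tendsto hlim' hlim ?_
  filter_upwards [eventually_gt_atTop 0] with N hN
  have hN0 : (0 : ℝ) < N := by exact_mod_cast hN
  simp only [Function.comp_apply, id_eq]
  rw [le_div_iff₀ (by push_cast; positivity)]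
  refine le_trans (le_of_eq ?_) (hent N)
  push_cast
  field_simp

/-- From below, an entropy is at most the logarithm of the number of values, for measures nearly
attaining the supremum. From above, the block measures give `log N_n / n ≤ sup + C / n`. No
subadditivity of `log N_n` is needed. -/
lemma tendsto_log_card_div (hℓ : 1 ≤ ℓ) (hdet : A.det ≠ 0)
    (hA : ‖Matrix.toEuclideanCLM (𝕜 := ℝ) A‖ < 1)
    (hs : ∀ n, (s n : Set (Fin d → ℤ)) = range (cubeCode A c n))
    (hbdd : BddAbove (projEntropy (affineIFS A c) '' invariantMeasures ℓ)) :
    Tendsto (fun n : ℕ => Real.log (s n).card / n) atTop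
      (𝓝 (sSup (projEntropy (affineIFS A c) '' invariantMeasures ℓ))) := by
  obtain ⟨C, hC⟩ := exists_invariantMeasure_le_projEntropy hℓ hdet hA hs
  have hne : (projEntropy (affineIFS A c) '' invariantMeasures ℓ).Nonempty := by
    obtain ⟨m, hm, -⟩ := hC 1 one_pos
    exact ⟨_, m, hm, rfl⟩
  rw [tendsto_order]
  constructor
  · intro a ha
    obtain ⟨_, ⟨m, hm, rfl⟩, ham⟩ := exists_lt_of_lt_csSup hne ha
    have : IsProbabilityMeasure m := hm.1
    filter_upwards [(tendsto_finEntropy_finCode_div hs hℓ hdet hA hm.2).eventually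
      (lt_mem_nhds ham)] with n hn
    refine hn.trans_le ?_
    have : Nonempty (s n) := (nonempty_finset_of_coe_eq_range hℓ hs n).to_subtype
    have h := finEntropy_le_log_card (m := m) bot_le ((measurable_finCode_codingSigma hs n).mono
      (codingSigma_le hℓ hA) le_rfl)
    rw [Fintype.card_coe] at h
    gcongr
  · intro a ha
    have h0 : Tendsto (fun n : ℕ => sSup (projEntropy (affineIFS A c) '' invariantMeasures ℓ) +
        C / n) atTop (𝓝 (sSup (projEntropy (affineIFS A c) '' invariantMeasures ℓ))) := by
      simpa using (tendsto_const_div_atTop_nhds_zero_nat C).const_add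
        (sSup (projEntropy (affineIFS A c) '' invariantMeasures ℓ))
    filter_upwards [h0.eventually (gt_mem_nhds ha), eventually_gt_atTop 0] with n hn hn0
    obtain ⟨m, hm, hmn⟩ := hC n hn0
    have h1 := le_csSup hbdd ⟨m, hm, rfl⟩
    rw [sub_div] at hmn
    linarith

end Variational

theorem mainTheorem7 {d ℓ : ℕ} (hℓ : 1 ≤ ℓ) (A : Matrix (Fin d) (Fin d) ℝ)
    (hdet : A.det ≠ 0) (hA : ‖Matrix.toEuclideanCLM (𝕜 := ℝ) A‖ < 1)
    (c : Fin ℓ → EuclideanSpace ℝ (Fin d)) :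
    (∀ m ∈ invariantMeasures ℓ,
      Integrable (condInformation ((codingSigma (affineIFS A c)).comap leftShift)
        m cylinderOne) m ∧
      Integrable (condInformation (codingSigma (affineIFS A c)) m cylinderOne) m ∧
      (∀ n : ℕ, Integrable (condInformation ⊥ m (pulledCubes A c n)) m) ∧
      Tendsto (fun n : ℕ => partEntropy m (pulledCubes A c n) / (n : ℝ)) atTop
        (𝓝 (projEntropy (affineIFS A c) m))) ∧
    (∀ n : ℕ, (meetingCubes A c n).Finite) ∧
    BddAbove (projEntropy (affineIFS A c) '' invariantMeasures ℓ) ∧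
    Tendsto (fun n : ℕ => Real.log ((meetingCubes A c n).ncard : ℝ) / (n : ℝ)) atTop
      (𝓝 (sSup (projEntropy (affineIFS A c) '' invariantMeasures ℓ))) := by
  have hfin := finite_range_cubeCode hℓ hA c
  have hs : ∀ n, ((hfin n).toFinset : Set (Fin d → ℤ)) = range (cubeCode A c n) := fun n =>
    (hfin n).coe_toFinset
  have hbdd : BddAbove (projEntropy (affineIFS A c) '' invariantMeasures ℓ) := by
    refine ⟨Real.log ℓ, ?_⟩
    rintro _ ⟨m, hm, rfl⟩
    have : IsProbabilityMeasure m := hm.1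
    exact projEntropy_le_log hℓ hA
  refine ⟨fun m hm => ?_, fun n => ?_, hbdd, ?_⟩
  · have : IsProbabilityMeasure m := hm.1
    refine ⟨integrable_condInformation (s := Finset.univ) (comap_leftShift_codingSigma_le hℓ hA)
        (by simp) measurableSet_cylinderOne,
      integrable_condInformation (s := Finset.univ) (codingSigma_le hℓ hA) (by simp)
        measurableSet_cylinderOne,
      fun n => integrable_condInformation bot_le (fun α => pulledCubes_eq_empty hs hdet)
        (measurableSet_pulledCubes hℓ hdet hA n), ?_⟩
    simp only [partEntropy_pulledCubes hs hℓ hdet hA]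
    exact tendsto_finEntropy_finCode_div hs hℓ hdet hA hm.2
  · rw [meetingCubes_eq hℓ hdet hA]
    exact (hfin n).image _
  · simp only [ncard_meetingCubes hs hℓ hdet hA]
    exact tendsto_log_card_div hℓ hdet hA hs hbdd
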